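/- Let $I\in\mathbb N$ and, for $i\in\mathcal I=\{1,\dots,I\}$, let $\mathcal X_i\subseteq\mathcal U_i\subseteq\mathbb R^{n_i}$, $f_i:\mathcal U_i\to\mathbb R$, $\tilde{\mathbf g}_i:\mathcal U_i\to\mathbb R^{\tilde r}$, $\mathbf g_i:\mathcal U_i\to\mathbb R^{r_i}$, $\mathbf A_i\in\mathbb R^{\tilde m\times n_i}$, and $\mathbf b\in\mathbb R^{\tilde m}$. Write $\mathbf x=(\mathbf x_1,\dots,\mathbf x_I)$, $\mathcal X=\prod_i\mathcal X_i$, and consider $$\mathcal P^{sdd}:\quad \min_{\mathbf x}\ f(\mathbf x)=\sum_{i}f_i(\mathbf x_i)\quad\text{s.t.}\quad \sum_i\tilde{\mathbf g}_i(\mathbf x_i)\preceq\mathbf 0,\quad \sum_i\mathbf A_i\mathbf x_i+\mathbf b=\mathbf 0,\quad \mathbf g_i(\mathbf x_i)\preceq\mathbf 0,\ \mathbf x_i\in\mathcal X_i\ (i\in\mathcal I).$$ *Stationary and regular points.* For a problem $\min f(\mathbf x)$ s.t. $\mathbf g(\mathbf x)\preceq\mathbf 0$, $\mathbf h(\mathbf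 x)=\mathbf 0$, $\mathbf x\in\mathcal X$, a feasible point $\mathbf x$ is *stationary* if there are $\boldsymbol\mu\succeq\mathbf 0$ and $\boldsymbol\lambda$ such that $\langle\boldsymbol\mu\rangle_j\langle\mathbf g(\mathbf x)\rangle_j=0$ for all $j$ and $(\nabla f(\mathbf x)+\nabla\mathbf g(\mathbf x)\boldsymbol\mu+\nabla\mathbf h(\mathbf x)\boldsymbol\lambda)^T(\mathbf x'-\mathbf x)\ge 0$ for all $\mathbf x'\in\mathcal X$, where $\nabla$ of a vector function is its transposed Jacobian. A feasible point $\mathbf x$ is *regular* if $\boldsymbol\mu=\mathbf 0$, $\boldsymbol\lambda=\mathbf 0$ are the only vectors with $\boldsymbol\mu\succeq\mathbf 0$, $\langle\boldsymbol\mu\rangle_j=0$ whenever $\langle\mathbf g(\mathbf x)\rangle_j\neq0$, and $(\nabla\mathbf g(\mathbf x)\boldsymbol\mu+\nabla\mathbf h(\mathbf x)\boldsymbol\lambda)^T(\mathbf x'-\mathbf x)\ge0$ for all $\mathbf x'\in\mathcal X$. *Assumptions on $\mathcal P^{sdd}$.* (a) All feasible points of $\mathcal P^{sdd}$ are regular.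 (b) For all $i$: $\mathcal X_i$ is nonempty, closed and convex, and $\mathcal U_i$ is open; $f_i,\tilde{\mathbf g}_i,\mathbf g_i$ are continuously differentiable on $\mathcal U_i$; $\nabla f_i$ is Lipschitz continuous on $\mathcal X_i$. (c) $f$ is bounded below on the feasible set. *Assumptions on the approximate functions.* For every $i$, functions $F_i(\cdot;\cdot)$, $\widetilde{\mathbf G}_i(\cdot;\cdot)$, $\mathbf G_i(\cdot;\cdot)$ on $\mathcal U_i\times\mathcal X_i$ are given such that: (d) $F_i(\cdot;\mathbf y)$ is continuously differentiable on $\mathcal U_i$ for every $\mathbf y\in\mathcal X_i$; there is $c_i>0$ with $(\mathbf x-\mathbf x')^T(\nabla_{\mathbf x}F_i(\mathbf x;\mathbf y)-\nabla_{\mathbf x}F_i(\mathbf x';\mathbf y))\ge c_i\|\mathbf x-\mathbf x'\|_2^2$ for all $\mathbf x,\mathbf x',\mathbf y\in\mathcal X_i$; $\nabla_{\mathbf x}F_i(\mathbf y;\mathbf y)=\nabla f_i(\mathbf y)$ for all $\mathbf y\in\mathcal X_i$; and $\nabla_{\mathbf x}F_i(\cdot;\cdot)$ is continuous on $\mathcal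 U_i\times\mathcal X_i$. (e) For $(\mathbf g,\mathbf G)=(\tilde{\mathbf g}_i,\widetilde{\mathbf G}_i)$ and for $(\mathbf g,\mathbf G)=(\mathbf g_i,\mathbf G_i)$: for every $\mathbf y\in\mathcal X_i$, $\mathbf G(\cdot;\mathbf y)$ is (componentwise) convex on $\mathcal X_i$ and differentiable at every point of $\mathcal X_i$; $\mathbf G(\mathbf y;\mathbf y)=\mathbf g(\mathbf y)$ and $\nabla_{\mathbf x}\mathbf G(\mathbf y;\mathbf y)=\nabla\mathbf g(\mathbf y)$ for all $\mathbf y\in\mathcal X_i$; $\mathbf G(\mathbf x;\mathbf y)\succeq\mathbf g(\mathbf x)$ for all $\mathbf x,\mathbf y\in\mathcal X_i$; and $\mathbf G$ and $\nabla_{\mathbf x}\mathbf G$ are continuous on $\mathcal X_i\times\mathcal X_i$. *SDD-M.* Let $\gamma^{(k)}\in(0,1]$ with $\gamma^{(k)}\to0$ and $\sum_k\gamma^{(k)}=\infty$, and let $\mathbf x^{(0)}$ be feasible for $\mathcal P^{sdd}$. Given $\mathbf x^{(k)}$, put $L_i(\mathbf x_i,\tilde{\boldsymbol\mu},\tilde{\boldsymbol\lambda};\mathbf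 x_i^{(k)})=F_i(\mathbf x_i;\mathbf x_i^{(k)})+\tilde{\boldsymbol\mu}^T\widetilde{\mathbf G}_i(\mathbf x_i;\mathbf x_i^{(k)})+\tilde{\boldsymbol\lambda}^T\mathbf A_i\mathbf x_i$ and $$q(\tilde{\boldsymbol\mu},\tilde{\boldsymbol\lambda};\mathbf x^{(k)})=\inf\Big\{\sum_iL_i(\mathbf x_i,\tilde{\boldsymbol\mu},\tilde{\boldsymbol\lambda};\mathbf x_i^{(k)})+\tilde{\boldsymbol\lambda}^T\mathbf b\ \Big|\ \mathbf G_i(\mathbf x_i;\mathbf x_i^{(k)})\preceq\mathbf 0,\ \mathbf x_i\in\mathcal X_i,\ i\in\mathcal I\Big\}.$$ Let $(\tilde{\boldsymbol\mu}^{*,(k)},\tilde{\boldsymbol\lambda}^{*,(k)})$ maximize $q(\cdot,\cdot;\mathbf x^{(k)})$ over $\mathbb R_+^{\tilde r}\times\mathbb R^{\tilde m}$, let $\mathbf x_i^{*,(k)}$ minimize $L_i(\cdot,\tilde{\boldsymbol\mu}^{*,(k)},\tilde{\boldsymbol\lambda}^{*,(k)};\mathbf x_i^{(k)})$ subject to $\mathbf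 G_i(\mathbf x_i;\mathbf x_i^{(k)})\preceq\mathbf 0$, $\mathbf x_i\in\mathcal X_i$, for every $i$, and set $\mathbf x^{(k+1)}=\mathbf x^{(k)}+\gamma^{(k)}(\mathbf x^{*,(k)}-\mathbf x^{(k)})$. **Statement.** Under these assumptions, let $\{\mathbf x^{(k)}\}_{k\in\mathbb N}$ be any sequence generated by SDD-M that has a limit point (for instance, a bounded sequence). Then at least one limit point of $\{\mathbf x^{(k)}\}$ is a stationary point of $\mathcal P^{sdd}$. -/

import Mathlib

open scoped Matrix

noncomputable section

/-- The optimization problem `min f(x)` subject to `g(x) ⪯ 0`, `h(x) = 0`, `x ∈ X`. -/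
structure OptProblem (E J M : Type*) where
  /-- objective function -/
  f : E → ℝ
  /-- inequality constraint function -/
  g : E → J → ℝ
  /-- equality constraint function -/
  h : E → M → ℝ
  /-- convex constraint set -/
  X : Set E

namespace OptProblem

/-- The feasible set. -/
def feasible {E J M : Type*} (P : OptProblem E J M) : Set E :=
  {x | x ∈ P.X ∧ (∀ j, P.g x j ≤ 0) ∧ ∀ l, P.h x l = 0}

/-- `x` is a (globally) optimal point. -/
def IsOptimal {E J M : Type*} (P : OptProblem E J M) (x : E) : Prop :=
  x ∈ P.feasible ∧ ∀ z ∈ P.feasible, P.f x ≤ P.f z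

/-- `(∇g(x) μ + ∇h(x) lam)ᵀ v`, where `∇g(x)` is the transpose of the Jacobian matrix. -/
def constraintDeriv {E J M : Type*} [NormedAddCommGroup E] [InnerProductSpace ℝ E]
    [Fintype J] [Fintype M] (P : OptProblem E J M) (x : E) (μ : J → ℝ) (lam : M → ℝ)
    (v : E) : ℝ :=
  (∑ j, μ j * fderiv ℝ P.g x v j) + (∑ l, lam l * fderiv ℝ P.h x v l)

/-- The Karush-Kuhn-Tucker conditions at `x` with multipliers `μ` and `lam`. -/
def IsKKT {E J M : Type*} [NormedAddCommGroup E] [InnerProductSpace ℝ E]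
    [Fintype J] [Fintype M] (P : OptProblem E J M) (x : E) (μ : J → ℝ) (lam : M → ℝ) : Prop :=
  (∀ x' ∈ P.X, 0 ≤ fderiv ℝ P.f x (x' - x) + P.constraintDeriv x μ lam (x' - x)) ∧
  (∀ j, μ j * P.g x j = 0) ∧
  (∀ j, 0 ≤ μ j) ∧
  x ∈ P.feasible

/-- Stationary points. -/
def IsStationary {E J M : Type*} [NormedAddCommGroup E] [InnerProductSpace ℝ E]
    [Fintype J] [Fintype M] (P : OptProblem E J M) (x : E) : Prop :=
  ∃ (μ : J → ℝ) (lam : M → ℝ), P.IsKKT x μ lam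

/-- Regular points: feasible points at which the Mangasarian-Fromovitz constraint
qualification holds (in dual form, relative to the convex set `X`). -/
def IsRegular {E J M : Type*} [NormedAddCommGroup E] [InnerProductSpace ℝ E]
    [Fintype J] [Fintype M] (P : OptProblem E J M) (x : E) : Prop :=
  x ∈ P.feasible ∧
  ∀ (μ : J → ℝ) (lam : M → ℝ),
    (∀ x' ∈ P.X, 0 ≤ P.constraintDeriv x μ lam (x' - x)) →
    (∀ j, 0 ≤ μ j) →
    (∀ j, P.g x j ≠ 0 → μ j = 0) →
    μ = 0 ∧ lam = 0

end OptProblem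

/-- The data of `min ∑ᵢ fᵢ(xᵢ)` subject to `∑ᵢ g̃ᵢ(xᵢ) ⪯ 0`, `∑ᵢ Aᵢ xᵢ + b = 0`,
`gᵢ(xᵢ) ⪯ 0` and `xᵢ ∈ Xᵢ`, for blocks `xᵢ ∈ ℝ^{nᵢ}`, `i = 1, …, I`. The functions are
regarded as functions on the sets `Uᵢ`; their values outside of `Uᵢ` play no role. -/
structure SDDProblem (I : ℕ) (n r : Fin I → ℕ) (rt m : ℕ) where
  /-- open domains of the functions of the `i`-th block -/
  U : ∀ i, Set (EuclideanSpace ℝ (Fin (n i)))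
  /-- convex constraint sets -/
  X : ∀ i, Set (EuclideanSpace ℝ (Fin (n i)))
  /-- components of the objective function -/
  f : ∀ i, EuclideanSpace ℝ (Fin (n i)) → ℝ
  /-- components of the coupling inequality constraint -/
  gt : ∀ i, EuclideanSpace ℝ (Fin (n i)) → Fin rt → ℝ
  /-- local inequality constraints -/
  g : ∀ i, EuclideanSpace ℝ (Fin (n i)) → Fin (r i) → ℝ
  /-- matrices of the coupling linear equality constraint -/
  A : ∀ i, Matrix (Fin m) (Fin (n i)) ℝ
  /-- constant term of the coupling linear equality constraint -/
  b : Fin m → ℝ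

/-- The space of `x = (x₁, …, x_I)` with the Euclidean norm. -/
abbrev BlockSpace (I : ℕ) (n : Fin I → ℕ) : Type :=
  PiLp 2 (fun i : Fin I => EuclideanSpace ℝ (Fin (n i)))

namespace SDDProblem

/-- The coupled problem as an optimization problem in `x = (x₁, …, x_I)`; its inequality
constraints are the `rt` coupling ones together with the `r i` local ones of every block. -/
def problem {I : ℕ} {n r : Fin I → ℕ} {rt m : ℕ} (P : SDDProblem I n r rt m) :
    OptProblem (BlockSpace I n) (Fin rt ⊕ (Σ i : Fin I, Fin (r i))) (Fin m) where
  f := fun x => ∑ i, P.f i (x i)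
  g := fun x => Sum.elim (fun j => ∑ i, P.gt i (x i) j) (fun p => P.g p.1 (x p.1) p.2)
  h := fun x l => ((∑ i, P.A i *ᵥ (x i).ofLp) + P.b) l
  X := {x | ∀ i, x i ∈ P.X i}

/-- The assumptions on the coupled problem. -/
structure Assumptions {I : ℕ} {n r : Fin I → ℕ} {rt m : ℕ}
    (P : SDDProblem I n r rt m) : Prop where
  X_nonempty : ∀ i, (P.X i).Nonempty
  X_closed : ∀ i, IsClosed (P.X i)
  X_convex : ∀ i, Convex ℝ (P.X i)
  U_open : ∀ i, IsOpen (P.U i)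
  X_subset_U : ∀ i, P.X i ⊆ P.U i
  f_contDiff : ∀ i, ContDiffOn ℝ 1 (P.f i) (P.U i)
  f_lipschitz : ∀ i, ∃ K : NNReal, LipschitzOnWith K (gradient (P.f i)) (P.X i)
  gt_contDiff : ∀ i, ContDiffOn ℝ 1 (P.gt i) (P.U i)
  g_contDiff : ∀ i, ContDiffOn ℝ 1 (P.g i) (P.U i)
  f_bddBelow : BddBelow (P.problem.f '' P.problem.feasible)

end SDDProblem

/-- `F(x; y)`, written `F x y`, is a strongly convex approximation of `f`. -/
structure IsObjectiveSurrogate {E : Type*} [NormedAddCommGroup E] [InnerProductSpace ℝ E]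
    [CompleteSpace E] (U X : Set E) (f : E → ℝ) (F : E → E → ℝ) : Prop where
  contDiff : ∀ y ∈ X, ContDiffOn ℝ 1 (fun x => F x y) U
  strongConvex : ∃ c : ℝ, 0 < c ∧ ∀ x ∈ X, ∀ x' ∈ X, ∀ y ∈ X,
    c * ‖x - x'‖ ^ 2 ≤
      inner ℝ (x - x') (gradient (fun z => F z y) x - gradient (fun z => F z y) x')
  gradient_eq : ∀ y ∈ X, gradient (fun z => F z y) y = gradient f y
  gradient_continuous :
    ContinuousOn (fun p : E × E => gradient (fun z => F z p.2) p.1) (U ×ˢ X)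

/-- `G(x; y)`, written `G x y`, is a convex approximation from above of the vector
function `g`. -/
structure IsConstraintSurrogate {E J : Type*} [NormedAddCommGroup E] [InnerProductSpace ℝ E]
    [Fintype J] (X : Set E) (g : E → J → ℝ) (G : E → E → J → ℝ) : Prop where
  convex : ∀ y ∈ X, ∀ j, ConvexOn ℝ X (fun x => G x y j)
  eq_self : ∀ y ∈ X, G y y = g y
  majorant : ∀ x ∈ X, ∀ y ∈ X, ∀ j, g x j ≤ G x y j
  continuous : ContinuousOn (fun p : E × E => G p.1 p.2) (X ×ˢ X)
  differentiable : ∀ x ∈ X, ∀ y ∈ X, DifferentiableAt ℝ (fun z => G z y) x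
  deriv_eq : ∀ y ∈ X, fderiv ℝ (fun z => G z y) y = fderiv ℝ g y
  deriv_continuous :
    ContinuousOn (fun p : E × E => fderiv ℝ (fun z => G z p.2) p.1) (X ×ˢ X)

/-- Approximate functions for the blocks of the coupled problem: `F i x y = Fᵢ(x; y)`,
`Gt i x y = G̃ᵢ(x; y)` and `G i x y = Gᵢ(x; y)`. -/
structure SDDSurrogate (I : ℕ) (n r : Fin I → ℕ) (rt : ℕ) where
  /-- approximations of `fᵢ` -/
  F : ∀ i, EuclideanSpace ℝ (Fin (n i)) → EuclideanSpace ℝ (Fin (n i)) → ℝ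
  /-- approximations of `g̃ᵢ` -/
  Gt : ∀ i, EuclideanSpace ℝ (Fin (n i)) → EuclideanSpace ℝ (Fin (n i)) → Fin rt → ℝ
  /-- approximations of `gᵢ` -/
  G : ∀ i, EuclideanSpace ℝ (Fin (n i)) → EuclideanSpace ℝ (Fin (n i)) → Fin (r i) → ℝ

namespace SDDProblem

/-- The assumptions on the approximate functions, for every block. -/
structure SurrogateAssumptions {I : ℕ} {n r : Fin I → ℕ} {rt m : ℕ}
    (P : SDDProblem I n r rt m) (S : SDDSurrogate I n r rt) : Prop where
  F_surrogate : ∀ i, IsObjectiveSurrogate (P.U i) (P.X i) (P.f i) (S.F i)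
  Gt_surrogate : ∀ i, IsConstraintSurrogate (P.X i) (P.gt i) (S.Gt i)
  G_surrogate : ∀ i, IsConstraintSurrogate (P.X i) (P.g i) (S.G i)

/-- The convex approximate problem at `y`: minimize `∑ᵢ Fᵢ(xᵢ; yᵢ)` subject to
`∑ᵢ G̃ᵢ(xᵢ; yᵢ) ⪯ 0`, `∑ᵢ Aᵢ xᵢ + b = 0`, `Gᵢ(xᵢ; yᵢ) ⪯ 0` and `xᵢ ∈ Xᵢ`. -/
def approx {I : ℕ} {n r : Fin I → ℕ} {rt m : ℕ} (P : SDDProblem I n r rt m)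
    (S : SDDSurrogate I n r rt) (y : BlockSpace I n) : SDDProblem I n r rt m where
  U := P.U
  X := P.X
  f := fun i x => S.F i x (y i)
  gt := fun i x => S.Gt i x (y i)
  g := fun i x => S.G i x (y i)
  A := P.A
  b := P.b

/-- The component `Lᵢ(xᵢ, μ, lam) = fᵢ(xᵢ) + μᵀ g̃ᵢ(xᵢ) + lamᵀ Aᵢ xᵢ` of the partial
Lagrangian, in which only the coupling constraints are relaxed. -/
def lagrangianBlock {I : ℕ} {n r : Fin I → ℕ} {rt m : ℕ} (Q : SDDProblem I n r rt m)
    (μ : Fin rt → ℝ) (lam : Fin m → ℝ) (i : Fin I) (x : EuclideanSpace ℝ (Fin (n i))) : ℝ :=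
  Q.f i x + μ ⬝ᵥ Q.gt i x + lam ⬝ᵥ (Q.A i *ᵥ x.ofLp)

/-- The partial Lagrangian `∑ᵢ Lᵢ(xᵢ, μ, lam) + lamᵀ b`. -/
def lagrangian {I : ℕ} {n r : Fin I → ℕ} {rt m : ℕ} (Q : SDDProblem I n r rt m)
    (μ : Fin rt → ℝ) (lam : Fin m → ℝ) (x : BlockSpace I n) : ℝ :=
  (∑ i, Q.lagrangianBlock μ lam i (x i)) + lam ⬝ᵥ Q.b

/-- The dual function: the infimum of the partial Lagrangian over all `x` with
`gᵢ(xᵢ) ⪯ 0` and `xᵢ ∈ Xᵢ` for all `i`. -/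
def dualFunction {I : ℕ} {n r : Fin I → ℕ} {rt m : ℕ} (Q : SDDProblem I n r rt m)
    (μ : Fin rt → ℝ) (lam : Fin m → ℝ) : EReal :=
  ⨅ x ∈ {x : BlockSpace I n | ∀ i, x i ∈ Q.X i ∧ ∀ j, Q.g i (x i) j ≤ 0},
    (Q.lagrangian μ lam x : EReal)

/-- `(μ, lam)` is an optimal point of the master (dual) problem: maximize the dual function
subject to `μ ⪰ 0`. -/
def IsMasterOptimal {I : ℕ} {n r : Fin I → ℕ} {rt m : ℕ} (Q : SDDProblem I n r rt m)
    (μ : Fin rt → ℝ) (lam : Fin m → ℝ) : Prop :=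
  (∀ j, 0 ≤ μ j) ∧
  ∀ (μ' : Fin rt → ℝ) (lam' : Fin m → ℝ), (∀ j, 0 ≤ μ' j) →
    Q.dualFunction μ' lam' ≤ Q.dualFunction μ lam

/-- The `i`-th dual subproblem: minimize `Lᵢ(xᵢ, μ, lam)` subject to `gᵢ(xᵢ) ⪯ 0` and
`xᵢ ∈ Xᵢ` (there is no equality constraint). -/
def subproblem {I : ℕ} {n r : Fin I → ℕ} {rt m : ℕ} (Q : SDDProblem I n r rt m)
    (μ : Fin rt → ℝ) (lam : Fin m → ℝ) (i : Fin I) :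
    OptProblem (EuclideanSpace ℝ (Fin (n i))) (Fin (r i)) Empty where
  f := Q.lagrangianBlock μ lam i
  g := Q.g i
  h := fun _ l => l.elim
  X := Q.X i

/-- `x` is a sequence of iterates of the successive dual decomposition method with step
sizes `γ`: in iteration `k`, `(μ k, lam k)` is an optimal point of the master problem of the
convex approximate problem at `x k`, the blocks of `xs k` are optimal points of the dual
subproblems at `(μ k, lam k)`, and the method takes the step `γ k` from `x k` towards
`xs k`. -/
structure IsSDDM {I : ℕ} {n r : Fin I → ℕ} {rt m : ℕ} (P : SDDProblem I n r rt m)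
    (S : SDDSurrogate I n r rt) (γ : ℕ → ℝ) (x xs : ℕ → BlockSpace I n)
    (μ : ℕ → Fin rt → ℝ) (lam : ℕ → Fin m → ℝ) : Prop where
  step_mem : ∀ k, γ k ∈ Set.Ioc (0 : ℝ) 1
  step_tendsto : Filter.Tendsto γ Filter.atTop (nhds 0)
  step_sum : Filter.Tendsto (fun N => ∑ k ∈ Finset.range N, γ k) Filter.atTop Filter.atTop
  init : x 0 ∈ P.problem.feasible
  master : ∀ k, (P.approx S (x k)).IsMasterOptimal (μ k) (lam k)
  sub : ∀ k i, ((P.approx S (x k)).subproblem (μ k) (lam k) i).IsOptimal (xs k i)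
  update : ∀ k, x (k + 1) = x k + γ k • (xs k - x k)

end SDDProblem

end

/-! At a feasible point `y` the convex approximate problem is a tight inner approximation: `y` is
feasible for it, its feasible set lies in the original one, and the constraint values and all first
derivatives agree at `y`. Regularity of `y` is therefore inherited, and it rules out degenerate
Fritz John multipliers. Hence the approximate problem has Lagrange multipliers and no duality gap.
Since its objective is strongly convex, the blockwise minimizers of the Lagrangian at a dual optimum
can only be its unique solution (`eq_of_isMasterOptimal`, `isOptimal_and_isKKT_of_isMasterOptimal`).

Thus `xs k` solves the approximate problem at `x k`. Convexity keeps every iterate feasible, and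
with `d k = xs k - x k` strong convexity gives `∇f(x k)ᵀ d k ≤ -c ‖d k‖²`. As `∇f` is Lipschitz, `γ
k → 0` and `f` is bounded below, summing the decrease gives `∑ γ k ‖d k‖² < ∞`
(`summable_mul_sq_of_descent`).

Suppose that a limit point `z` is not stationary. Then `‖d k‖` is bounded away from zero whenever `x
k` is near `z`: otherwise `x k` and `xs k` could both be chosen arbitrarily close to `z`, and the
KKT conditions at `xs k` would pass to the limit, the multipliers being controlled by regularity of
`z` (`isStationary_of_tendsto`). But with such a lower bound, an iterate that is late and close
enough to `z` can never leave the neighbourhood, because the remaining path is too short, and then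
`∑ γ k` is finite (`not_mapClusterPt_of_summable_of_le_norm`). This contradiction shows that every
limit point is stationary, not only one of them. -/

/-! ### Convex separation and Fritz John multipliers -/

/-- In finite dimension, a nonempty convex set not containing the origin lies in a closed
half-space bounded by a hyperplane through the origin. -/
theorem Convex.exists_nonneg_functional {V : Type*} [NormedAddCommGroup V] [NormedSpace ℝ V]
    [FiniteDimensional ℝ V] {C : Set V} (hC : Convex ℝ C) (hne : C.Nonempty)
    (h0 : (0 : V) ∉ C) : ∃ l : V →ₗ[ℝ] ℝ, l ≠ 0 ∧ ∀ c ∈ C, 0 ≤ l c := by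
  by_cases hint : (interior C).Nonempty
  · obtain ⟨l, hl, hlC⟩ := geometric_hahn_banach_of_nonempty_interior_point hC
      (fun h => h0 (interior_subset h)) hint
    refine ⟨-(l : V →ₗ[ℝ] ℝ), fun h => hl ?_, fun c hc => ?_⟩
    · ext v
      have := congrArg (fun q : V →ₗ[ℝ] ℝ => q v) h
      simpa using this
    · have := hlC c hc
      simpa using this
  -- With empty interior, `C` spans a proper affine subspace. A nonzero functional killing its
  -- direction is constant on `C`, so one of its two signs works.
  · rw [hC.interior_nonempty_iff_affineSpan_eq_top] at hint
    obtain ⟨c₀, hc₀⟩ := hne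
    have hdir : (affineSpan ℝ C).direction ≠ ⊤ := fun h => hint
      ((AffineSubspace.direction_eq_top_iff_of_nonempty ⟨c₀, subset_affineSpan ℝ C hc₀⟩).1 h)
    obtain ⟨l, hl, hker⟩ := Submodule.exists_le_ker_of_lt_top _ (lt_top_iff_ne_top.2 hdir)
    have hconst : ∀ c ∈ C, l c = l c₀ := fun c hc => by
      have : c - c₀ ∈ (affineSpan ℝ C).direction := AffineSubspace.vsub_mem_direction
        (subset_affineSpan ℝ C hc) (subset_affineSpan ℝ C hc₀)
      have := LinearMap.mem_ker.1 (hker this)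
      rwa [map_sub, sub_eq_zero] at this
    rcases le_total 0 (l c₀) with h | h
    · exact ⟨l, hl, fun c hc => by rwa [hconst c hc]⟩
    · exact ⟨-l, neg_ne_zero.2 hl, fun c hc => by simpa [hconst c hc] using h⟩

/-- The Fritz John conditions for a convex problem. -/
theorem exists_fritzJohn_multipliers {E J M : Type*} [AddCommGroup E] [Module ℝ E] [Fintype J]
    [Fintype M] {X : Set E} (hX : Convex ℝ X) {f : E → ℝ} {g : E → J → ℝ} {h : E → M → ℝ}
    (hf : ConvexOn ℝ X f) (hg : ∀ j, ConvexOn ℝ X (fun x => g x j))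
    (hh : ∀ x y : E, ∀ a b : ℝ, a + b = 1 → ∀ l, h (a • x + b • y) l = a * h x l + b * h y l)
    {z : E} (hz : z ∈ X) (hgz : ∀ j, g z j ≤ 0) (hhz : ∀ l, h z l = 0)
    (hopt : ∀ x ∈ X, (∀ j, g x j ≤ 0) → (∀ l, h x l = 0) → f z ≤ f x) :
    ∃ (τ : ℝ) (μ : J → ℝ) (lam : M → ℝ), 0 ≤ τ ∧ (∀ j, 0 ≤ μ j) ∧
      ¬(τ = 0 ∧ μ = 0 ∧ lam = 0) ∧
      ∀ x ∈ X, 0 ≤ τ * (f x - f z) + ∑ j, μ j * g x j + ∑ l, lam l * h x l := by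
  classical
  -- Attainable values with upward slack in the objective and the inequalities. The strict
  -- inequality in the objective slot is what keeps the origin out, by optimality of `z`; the slack
  -- makes `C` convex and forces the signs of the multipliers.
  let C : Set (ℝ × (J → ℝ) × (M → ℝ)) :=
    {p | ∃ x ∈ X, f x - f z < p.1 ∧ (∀ j, g x j ≤ p.2.1 j) ∧ ∀ l, h x l = p.2.2 l}
  have hC : Convex ℝ C := by
    rintro ⟨t, u, w⟩ ⟨x, hx, hxt, hxu, hxw⟩ ⟨t', u', w'⟩ ⟨y, hy, hyt, hyu, hyw⟩ a b ha hb hab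
    refine ⟨a • x + b • y, hX hx hy ha hb hab, ?_, fun j => ?_, fun l => ?_⟩
    · have h1 := hf.2 hx hy ha hb hab
      simp only [smul_eq_mul, Prod.smul_mk, Prod.mk_add_mk] at h1 hxt hyt ⊢
      have h2 : f z = a * f z + b * f z := by rw [← add_mul, hab, one_mul]
      rcases ha.eq_or_lt with rfl | ha'
      · have : b = 1 := by linarith
        subst this
        linarith
      · have := mul_lt_mul_of_pos_left hxt ha'
        have := mul_le_mul_of_nonneg_left hyt.le hb
        linarith
    · have h1 := (hg j).2 hx hy ha hb hab
      simp only [smul_eq_mul, Prod.smul_mk, Prod.mk_add_mk, Pi.add_apply, Pi.smul_apply]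
        at h1 hxu hyu ⊢
      have := mul_le_mul_of_nonneg_left (hxu j) ha
      have := mul_le_mul_of_nonneg_left (hyu j) hb
      linarith
    · simp only [smul_eq_mul, Prod.smul_mk, Prod.mk_add_mk, Pi.add_apply, Pi.smul_apply]
        at hxw hyw ⊢
      rw [hh x y a b hab, hxw, hyw]
  have hzC : ∀ (t : ℝ) (u : J → ℝ), 0 < t → (∀ j, 0 ≤ u j) → (t, u, (0 : M → ℝ)) ∈ C :=
    fun t u ht hu => ⟨z, hz, by simpa using ht, fun j => (hgz j).trans (hu j), by simpa using hhz⟩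
  have h0 : (0 : ℝ × (J → ℝ) × (M → ℝ)) ∉ C := by
    rintro ⟨x, hx, hx1, hx2, hx3⟩
    have := hopt x hx (fun j => by simpa using hx2 j) (fun l => by simpa using hx3 l)
    simp only [Prod.fst_zero] at hx1
    linarith
  obtain ⟨ℓ, hℓ, hℓC⟩ := hC.exists_nonneg_functional ⟨_, hzC 1 0 one_pos fun _ => le_rfl⟩ h0
  have hdecomp : ∀ (t : ℝ) (u : J → ℝ) (w : M → ℝ), ℓ (t, u, w) =
      ℓ (1, 0, 0) * t + ∑ j, ℓ (0, Pi.single j 1, 0) * u j +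
        ∑ l, ℓ (0, 0, Pi.single l 1) * w l := by
    intro t u w
    have e : (t, u, w) = t • ((1 : ℝ), (0 : J → ℝ), (0 : M → ℝ)) +
        ∑ j, u j • ((0 : ℝ), (Pi.single j 1 : J → ℝ), (0 : M → ℝ)) +
        ∑ l, w l • ((0 : ℝ), (0 : J → ℝ), (Pi.single l 1 : M → ℝ)) := by
      refine Prod.ext ?_ (Prod.ext ?_ ?_)
      · simp [Prod.fst_sum]
      · ext j
        simp [Prod.fst_sum, Prod.snd_sum, Finset.sum_apply, Pi.single_apply]
      · ext l
        simp [Prod.snd_sum, Finset.sum_apply, Pi.single_apply]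
    rw [e]
    simp only [map_add, map_sum, map_smul, smul_eq_mul, mul_comm]
  refine ⟨ℓ (1, 0, 0), fun j => ℓ (0, Pi.single j 1, 0), fun l => ℓ (0, 0, Pi.single l 1),
    hℓC _ (hzC 1 0 one_pos fun _ => le_rfl), fun j => ?_, ?_, fun x hx => ?_⟩
  · by_contra! hneg
    set β := ℓ (0, Pi.single j 1, 0) with hβ
    have hs : ∀ s : ℝ, 0 ≤ s → 0 ≤ ℓ (1, 0, 0) + s * β := by
      intro s hs
      have := hℓC _ (hzC 1 (Pi.single j s) one_pos
        (fun i => (Pi.single_nonneg.2 hs : (0 : J → ℝ) ≤ Pi.single j s) i))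
      rw [hdecomp] at this
      simpa [Pi.single_apply, mul_comm] using this
    have hτ : 0 ≤ ℓ (1, 0, 0) := by simpa using hs 0 le_rfl
    -- This slack is chosen so that a negative `β` would give the functional the value `-1` on `C`.
    have := hs ((ℓ (1, 0, 0) + 1) / (-β)) (div_nonneg (by linarith) (by linarith))
    have h3 : (ℓ (1, 0, 0) + 1) / (-β) * β = -(ℓ (1, 0, 0) + 1) := by
      rw [div_neg, neg_mul, div_mul_cancel₀ _ hneg.ne]
    linarith
  · rintro ⟨h1, h2, h3⟩
    apply hℓ
    refine LinearMap.ext fun ⟨t, u, w⟩ => ?_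
    rw [hdecomp, h1]
    have h2' : ∀ j, ℓ (0, Pi.single j 1, 0) = 0 := fun j => congrFun h2 j
    have h3' : ∀ l, ℓ (0, 0, Pi.single l 1) = 0 := fun l => congrFun h3 l
    simp [h2', h3']
  -- The exact values at `x` miss `C` because of the strict inequality, so the objective slot is
  -- raised by `ε`, and `ε` then tends to zero.
  · have hε : ∀ ε : ℝ, 0 < ε → 0 ≤ (ℓ (1, 0, 0) * (f x - f z) +
        ∑ j, ℓ (0, Pi.single j 1, 0) * g x j + ∑ l, ℓ (0, 0, Pi.single l 1) * h x l)
          + ε * ℓ (1, 0, 0) := by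
      intro ε hε
      have := hℓC (f x - f z + ε, g x, h x) ⟨x, hx, by simpa using hε, fun _ => le_rfl,
        fun _ => rfl⟩
      rw [hdecomp] at this
      linarith
    have hlim : Filter.Tendsto (fun ε : ℝ => (ℓ (1, 0, 0) * (f x - f z) +
        ∑ j, ℓ (0, Pi.single j 1, 0) * g x j + ∑ l, ℓ (0, 0, Pi.single l 1) * h x l)
          + ε * ℓ (1, 0, 0)) (nhdsWithin 0 (Set.Ioi 0)) (nhds ((ℓ (1, 0, 0) * (f x - f z) +
        ∑ j, ℓ (0, Pi.single j 1, 0) * g x j + ∑ l, ℓ (0, 0, Pi.single l 1) * h x l)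
          + 0 * ℓ (1, 0, 0))) := by
      apply Filter.Tendsto.mono_left _ nhdsWithin_le_nhds
      exact (continuous_const.add (continuous_id.mul continuous_const)).tendsto _
    rw [zero_mul, add_zero] at hlim
    exact ge_of_tendsto hlim (eventually_mem_nhdsWithin.mono fun ε hε' => hε ε hε')

/-! ### First-order conditions and quadratic bounds on convex sets -/

/-- First-order necessary condition for a minimum on a convex set. -/
theorem IsMinOn.fderiv_nonneg {E : Type*} [NormedAddCommGroup E] [NormedSpace ℝ E] {X : Set E}
    (hX : Convex ℝ X) {φ : E → ℝ} {φ' : E →L[ℝ] ℝ} {u : E} (hu : u ∈ X) (hmin : IsMinOn φ X u)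
    (hφ : HasFDerivAt φ φ' u) {v : E} (hv : v ∈ X) : 0 ≤ φ' (v - u) :=
  hmin.localize.hasFDerivWithinAt_nonneg hφ.hasFDerivWithinAt
    (sub_mem_posTangentConeAt_of_segment_subset (hX.segment_subset hu hv))

/-- A quadratic lower bound from a linear lower bound on the growth of the derivative along
a segment. -/
theorem add_fderiv_add_le_of_forall_segment {E : Type*} [NormedAddCommGroup E] [NormedSpace ℝ E]
    {f : E → ℝ} {u v : E} {C : ℝ}
    (hf : ∀ t ∈ Set.Icc (0 : ℝ) 1, DifferentiableAt ℝ f (u + t • (v - u)))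
    (hC : ∀ t ∈ Set.Icc (0 : ℝ) 1,
      fderiv ℝ f u (v - u) + C * t ≤ fderiv ℝ f (u + t • (v - u)) (v - u)) :
    f u + fderiv ℝ f u (v - u) + C / 2 ≤ f v := by
  -- The tangent and the integral of `C * t` are subtracted, so the hypothesis says that `ψ` is
  -- nondecreasing; the claim is `ψ 0 ≤ ψ 1`. The sign of `C` is free.
  let ψ : ℝ → ℝ := fun t => f (u + t • (v - u)) - fderiv ℝ f u (v - u) * t - C / 2 * t ^ 2
  have hd : ∀ t ∈ Set.Icc (0 : ℝ) 1, HasDerivAt ψ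
      (fderiv ℝ f (u + t • (v - u)) (v - u) - fderiv ℝ f u (v - u) - C * t) t := by
    intro t ht
    have h1 : HasDerivAt (fun s : ℝ => u + s • (v - u)) (v - u) t := by
      simpa using ((hasDerivAt_id t).smul_const (v - u)).const_add u
    have h2 := (hf t ht).hasFDerivAt.comp_hasDerivAt t h1
    have h3 := (hasDerivAt_id t).const_mul (fderiv ℝ f u (v - u))
    have h4 := (hasDerivAt_pow 2 t).const_mul (C / 2)
    refine ((h2.sub h3).sub h4).congr_deriv ?_
    simp only [mul_one, Nat.cast_ofNat, Nat.add_one_sub_one, pow_one]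
    ring
  have hmono : MonotoneOn ψ (Set.Icc 0 1) := by
    refine monotoneOn_of_hasDerivWithinAt_nonneg (convex_Icc 0 1)
      (fun t ht => (hd t ht).continuousAt.continuousWithinAt)
      (fun t ht => (hd t (interior_subset ht)).hasDerivWithinAt) fun t ht => ?_
    linarith [hC t (interior_subset ht)]
  have := hmono (Set.left_mem_Icc.2 zero_le_one) (Set.right_mem_Icc.2 zero_le_one) zero_le_one
  simp only [ψ, zero_smul, add_zero, one_smul, add_sub_cancel] at this
  linarith

/-- A function lying quadratically above its tangents on a convex set is strictly convex. -/
theorem strictConvexOn_of_quadratic_lower_bound {E : Type*} [NormedAddCommGroup E]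
    [NormedSpace ℝ E] {X : Set E} (hX : Convex ℝ X) {f : E → ℝ} {c : ℝ} (hc : 0 < c)
    (f' : E → E →L[ℝ] ℝ)
    (h : ∀ u ∈ X, ∀ v ∈ X, f u + f' u (v - u) + c * ‖v - u‖ ^ 2 ≤ f v) :
    StrictConvexOn ℝ X f := by
  refine ⟨hX, fun u hu v hv huv a b ha hb hab => ?_⟩
  set w := a • u + b • v with hw
  have hwX : w ∈ X := hX hu hv ha.le hb.le hab
  have hu1 : u - w = b • (u - v) := by
    rw [hw, eq_sub_of_add_eq hab]
    module
  have hv1 : v - w = -(a • (u - v)) := by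
    rw [hw, eq_sub_of_add_eq' hab]
    module
  have h1 := h w hwX u hu
  have h2 := h w hwX v hv
  have hpos : 0 < c * ‖u - w‖ ^ 2 := by
    have : 0 < ‖u - w‖ := by
      rw [hu1, norm_smul, Real.norm_of_nonneg hb.le]
      exact mul_pos hb (norm_pos_iff.2 (sub_ne_zero.2 huv))
    positivity
  have hnn : 0 ≤ c * ‖v - w‖ ^ 2 := by positivity
  -- The tangent terms at `w` cancel in the weighted average, leaving only the quadratic gain.
  have hlin : a * f' w (u - w) + b * f' w (v - w) = 0 := by
    rw [hu1, hv1]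
    simp only [map_smul, map_neg, smul_eq_mul]
    ring
  have hsum : a * f w + b * f w = f w := by rw [← add_mul, hab, one_mul]
  simp only [smul_eq_mul]
  nlinarith [mul_le_mul_of_nonneg_left h1 ha.le, mul_le_mul_of_nonneg_left h2 hb.le,
    mul_pos ha hpos, mul_nonneg hb.le hnn]

/-- A continuous function growing quadratically from a point attains its minimum on a closed
set containing that point. -/
theorem exists_isMinOn_of_quadratic_growth {E : Type*} [NormedAddCommGroup E] [NormedSpace ℝ E]
    [FiniteDimensional ℝ E] {C : Set E} (hC : IsClosed C) {f : E → ℝ} (hf : ContinuousOn f C)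
    {y : E} (hy : y ∈ C) {c : ℝ} (hc : 0 < c) (l : E →L[ℝ] ℝ)
    (h : ∀ v ∈ C, f y + l (v - y) + c * ‖v - y‖ ^ 2 ≤ f v) : ∃ z ∈ C, IsMinOn f C z := by
  -- Beyond distance `‖l‖ / c` from `y` the quadratic term outweighs the linear one, so no value
  -- there is below `f y`.
  set R := ‖l‖ / c
  have hK : IsCompact (C ∩ Metric.closedBall y R) := (isCompact_closedBall y R).inter_left hC
  have hyK : y ∈ C ∩ Metric.closedBall y R :=
    ⟨hy, Metric.mem_closedBall_self (div_nonneg (norm_nonneg _) hc.le)⟩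
  obtain ⟨z, hz, hmin⟩ := hK.exists_isMinOn ⟨y, hyK⟩ (hf.mono Set.inter_subset_left)
  refine ⟨z, hz.1, isMinOn_iff.2 fun v hv => ?_⟩
  rw [isMinOn_iff] at hmin
  by_cases hvR : v ∈ Metric.closedBall y R
  · exact hmin v ⟨hv, hvR⟩
  · refine (hmin y hyK).trans ?_
    rw [Metric.mem_closedBall, not_le, dist_eq_norm, div_lt_iff₀ hc] at hvR
    have h1 := h v hv
    have h2 : -(‖l‖ * ‖v - y‖) ≤ l (v - y) := by
      have := l.le_opNorm (v - y)
      rw [Real.norm_eq_abs] at this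
      exact (abs_le.1 this).1
    nlinarith [norm_nonneg (v - y)]

/-! ### Compactness of multipliers -/

/-- Multipliers of a sequence of variational inequalities converge along a subsequence if the
limit satisfies the dual form of the Mangasarian-Fromovitz constraint qualification. -/
theorem exists_multipliers_of_tendsto {V J M : Type*} [Fintype J] [Fintype M] {T : Set V}
    {a : ℕ → V → ℝ} {b : ℕ → V → J → ℝ} {c : ℕ → V → M → ℝ} {s : ℕ → J → ℝ}
    {a' : V → ℝ} {b' : V → J → ℝ} {c' : V → M → ℝ} {s' : J → ℝ}
    (ha : ∀ v ∈ T, Filter.Tendsto (fun k => a k v) Filter.atTop (nhds (a' v)))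
    (hb : ∀ v ∈ T, ∀ j, Filter.Tendsto (fun k => b k v j) Filter.atTop (nhds (b' v j)))
    (hc : ∀ v ∈ T, ∀ l, Filter.Tendsto (fun k => c k v l) Filter.atTop (nhds (c' v l)))
    (hs : ∀ j, Filter.Tendsto (fun k => s k j) Filter.atTop (nhds (s' j)))
    (hk : ∀ k, ∃ (μ : J → ℝ) (lam : M → ℝ), (∀ j, 0 ≤ μ j) ∧ (∀ j, μ j * s k j = 0) ∧
      ∀ v ∈ T, 0 ≤ a k v + ((∑ j, μ j * b k v j) + ∑ l, lam l * c k v l))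
    (hreg : ∀ (μ : J → ℝ) (lam : M → ℝ),
      (∀ v ∈ T, 0 ≤ (∑ j, μ j * b' v j) + ∑ l, lam l * c' v l) → (∀ j, 0 ≤ μ j) →
      (∀ j, s' j ≠ 0 → μ j = 0) → μ = 0 ∧ lam = 0) :
    ∃ (μ : J → ℝ) (lam : M → ℝ), (∀ j, 0 ≤ μ j) ∧ (∀ j, μ j * s' j = 0) ∧
      ∀ v ∈ T, 0 ≤ a' v + ((∑ j, μ j * b' v j) + ∑ l, lam l * c' v l) := by
  choose μ lam hμ hμs hvar using hk
  -- The multipliers may be unbounded, so they are normalized together with the weight `1` of the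
  -- objective, which also keeps `q k` nonzero.
  let q : ℕ → ℝ × (J → ℝ) × (M → ℝ) := fun k => (1, μ k, lam k)
  have hq : ∀ k, 0 < ‖q k‖ := fun k => norm_pos_iff.2 fun h => by
    have := congrArg Prod.fst h
    simp [q] at this
  have hmem : ∀ k, ‖q k‖⁻¹ • q k ∈ Metric.sphere (0 : ℝ × (J → ℝ) × (M → ℝ)) 1 := fun k => by
    rw [mem_sphere_zero_iff_norm, norm_smul, norm_inv, norm_norm, inv_mul_cancel₀ (hq k).ne']
  obtain ⟨⟨τ, μ', lam'⟩, hp, φ, hφ, hlim⟩ := (isCompact_sphere _ _).tendsto_subseq hmem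
  have hτ : Filter.Tendsto (fun k => ‖q (φ k)‖⁻¹) Filter.atTop (nhds τ) := by
    simpa [q, Function.comp_def] using hlim.fst_nhds
  have hμ' : ∀ j, Filter.Tendsto (fun k => ‖q (φ k)‖⁻¹ * μ (φ k) j) Filter.atTop
      (nhds (μ' j)) := fun j => by
    simpa [q, Function.comp_def] using (tendsto_pi_nhds.1 hlim.snd_nhds.fst_nhds) j
  have hlam' : ∀ l, Filter.Tendsto (fun k => ‖q (φ k)‖⁻¹ * lam (φ k) l) Filter.atTop
      (nhds (lam' l)) := fun l => by
    simpa [q, Function.comp_def] using (tendsto_pi_nhds.1 hlim.snd_nhds.snd_nhds) l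
  have hτ0 : 0 ≤ τ := ge_of_tendsto' hτ fun k => inv_nonneg.2 (hq _).le
  have hμ0 : ∀ j, 0 ≤ μ' j := fun j =>
    ge_of_tendsto' (hμ' j) fun k => mul_nonneg (inv_nonneg.2 (hq _).le) (hμ _ j)
  have hcomp : ∀ j, μ' j * s' j = 0 := fun j => by
    refine tendsto_nhds_unique ((hμ' j).mul ((hs j).comp hφ.tendsto_atTop)) ?_
    simp [mul_assoc, hμs]
  have hineq : ∀ v ∈ T, 0 ≤ τ * a' v + ((∑ j, μ' j * b' v j) + ∑ l, lam' l * c' v l) := by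
    intro v hv
    have ht := (hτ.mul ((ha v hv).comp hφ.tendsto_atTop)).add
      ((tendsto_finsetSum Finset.univ fun j _ =>
        (hμ' j).mul ((hb v hv j).comp hφ.tendsto_atTop)).add
        (tendsto_finsetSum Finset.univ fun l _ =>
        (hlam' l).mul ((hc v hv l).comp hφ.tendsto_atTop)))
    refine ge_of_tendsto' ht fun k => ?_
    have := mul_nonneg (inv_nonneg.2 (hq (φ k)).le) (hvar (φ k) v hv)
    simpa only [mul_add, Finset.mul_sum, ← mul_assoc, Function.comp_def] using this
  -- If the objective loses its weight in the limit, `hreg` annihilates the remaining multipliers,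
  -- contradicting unit norm. Otherwise dividing by `τ` restores the weight `1`.
  rcases hτ0.eq_or_lt with rfl | hpos
  · obtain ⟨rfl, rfl⟩ := hreg μ' lam' (fun v hv => by simpa using hineq v hv) hμ0
      fun j hj => (mul_eq_zero.1 (hcomp j)).resolve_right hj
    simp at hp
  · refine ⟨fun j => τ⁻¹ * μ' j, fun l => τ⁻¹ * lam' l, fun j =>
      mul_nonneg (inv_nonneg.2 hpos.le) (hμ0 j), fun j => by rw [mul_assoc, hcomp, mul_zero],
      fun v hv => ?_⟩
    have := mul_nonneg (inv_nonneg.2 hpos.le) (hineq v hv)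
    simpa only [mul_add, Finset.mul_sum, ← mul_assoc, inv_mul_cancel₀ hpos.ne', one_mul]
      using this

/-! ### Step-size estimates -/

/-- A sequence moving in steps `γ k • d k` with `∑ γ k = ∞` and `∑ γ k * ‖d k‖ ^ 2 < ∞` has no
cluster point near which the directions `d k` are bounded away from zero. -/
theorem not_mapClusterPt_of_summable_of_le_norm {E : Type*} [NormedAddCommGroup E]
    [NormedSpace ℝ E] {x d : ℕ → E} {γ : ℕ → ℝ} (hγ : ∀ k, 0 ≤ γ k)
    (hsum : Filter.Tendsto (fun N => ∑ k ∈ Finset.range N, γ k) Filter.atTop Filter.atTop)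
    (hx : ∀ k, x (k + 1) = x k + γ k • d k) (hd : Summable fun k => γ k * ‖d k‖ ^ 2)
    {z : E} {ε δ : ℝ} (hε : 0 < ε) (hδ : 0 < δ) (hle : ∀ k, ‖x k - z‖ < ε → δ ≤ ‖d k‖) :
    ¬MapClusterPt z Filter.atTop x := by
  intro hz
  obtain ⟨N, hN⟩ : ∃ N, ∀ n ≥ N, ∑' k, γ (k + n) * ‖d (k + n)‖ ^ 2 < δ * (ε / 2) :=
    Filter.eventually_atTop.1 ((tendsto_sum_nat_add fun k => γ k * ‖d k‖ ^ 2).eventually_lt_const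
      (by positivity))
  have hfr := hz.frequently (Metric.ball_mem_nhds z (half_pos hε))
  obtain ⟨n, hn, hxn⟩ := Filter.frequently_atTop.1 hfr N
  rw [dist_eq_norm] at hxn
  have hpart : ∀ p, ∑ k ∈ Finset.range p, γ (k + n) * ‖d (k + n)‖ ^ 2 < δ * (ε / 2) := fun p =>
    (((summable_nat_add_iff n).2 hd).sum_le_tsum _ fun k _ => mul_nonneg (hγ _) (sq_nonneg _)).trans_lt
      (hN n hn)
  -- While the iterates stay in the ball, `δ γ ‖d‖ ≤ γ ‖d‖²`, so the distance travelled is below `ε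
  -- / 2`. Having started within `ε / 2` of `z`, they cannot escape.
  have hstay : ∀ p, ‖x (n + p) - z‖ < ε ∧
      δ * ‖x (n + p) - x n‖ ≤ ∑ k ∈ Finset.range p, γ (k + n) * ‖d (k + n)‖ ^ 2 := by
    intro p
    induction p with
    | zero => exact ⟨by simpa using hxn.trans (half_lt_self hε), by simp⟩
    | succ p ih =>
      have hdp := hle _ ih.1
      have hstep : δ * ‖x (n + (p + 1)) - x n‖ ≤
          ∑ k ∈ Finset.range (p + 1), γ (k + n) * ‖d (k + n)‖ ^ 2 := by
        rw [Finset.sum_range_succ, ← add_assoc, hx, add_sub_right_comm, add_comm p n]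
        have h1 : ‖γ (n + p) • d (n + p)‖ = γ (n + p) * ‖d (n + p)‖ := by
          rw [norm_smul, Real.norm_of_nonneg (hγ _)]
        have h2 := norm_add_le (x (n + p) - x n) (γ (n + p) • d (n + p))
        have h3 : δ * (γ (n + p) * ‖d (n + p)‖) ≤ γ (n + p) * ‖d (n + p)‖ ^ 2 := by
          nlinarith [mul_le_mul_of_nonneg_left hdp (mul_nonneg (hγ (n + p)) (norm_nonneg (d (n + p))))]
        have h4 := mul_le_mul_of_nonneg_left h2 hδ.le
        rw [h1, mul_add] at h4
        linarith [ih.2]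
      refine ⟨?_, hstep⟩
      have h5 : ‖x (n + (p + 1)) - x n‖ < ε / 2 :=
        lt_of_mul_lt_mul_left (hstep.trans_lt (hpart _)) hδ.le
      have h6 := norm_sub_le_norm_sub_add_norm_sub (x (n + (p + 1))) (x n) z
      linarith
  -- Trapped iterates have `‖d‖ ≥ δ` forever, so `δ² ∑ γ` is at most the tail bound `δ * (ε / 2)`.
  have hbound : ∀ p, ∑ k ∈ Finset.range p, γ (k + n) ≤ ε / 2 / δ := fun p => by
    rw [le_div_iff₀ hδ, ← mul_le_mul_iff_of_pos_right hδ]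
    refine le_trans ?_ ((hpart p).le.trans_eq (mul_comm _ _))
    rw [Finset.sum_mul, Finset.sum_mul]
    refine Finset.sum_le_sum fun k _ => ?_
    have := hle _ (hstay k).1
    rw [add_comm n k] at this
    rw [mul_assoc, ← sq]
    exact mul_le_mul_of_nonneg_left (pow_le_pow_left₀ hδ.le this 2) (hγ _)
  obtain ⟨K, hK⟩ := Filter.eventually_atTop.1
    (hsum.eventually_gt_atTop (∑ k ∈ Finset.range n, γ k + ε / 2 / δ))
  have h7 := hK (n + K) (Nat.le_add_left _ _)
  rw [Finset.sum_range_add] at h7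
  have h8 := hbound K
  simp only [add_comm n] at h7
  linarith

/-- Sufficient decrease with vanishing step sizes makes the steps square summable. -/
theorem summable_mul_sq_of_descent {v D γ : ℕ → ℝ} {c L B : ℝ} (hc : 0 < c)
    (hγ : ∀ k, 0 ≤ γ k) (hγ0 : Filter.Tendsto γ Filter.atTop (nhds 0)) (hB : ∀ k, B ≤ v k)
    (hv : ∀ k, v (k + 1) ≤ v k - c * (γ k * D k ^ 2) + L * γ k ^ 2 * D k ^ 2) :
    Summable fun k => γ k * D k ^ 2 := by
  -- Once `L * γ k` is below `c / 2`, the second-order error eats at most half of the decrease, and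
  -- the rest telescopes.
  have hev : ∀ᶠ k in Filter.atTop, L * γ k < c / 2 := by
    have := hγ0.const_mul L
    rw [mul_zero] at this
    exact this.eventually_lt_const (half_pos hc)
  obtain ⟨N, hN⟩ := Filter.eventually_atTop.1 hev
  rw [← summable_nat_add_iff N]
  have hdec : ∀ k, c / 2 * (γ (k + N) * D (k + N) ^ 2) ≤ v (k + N) - v (k + 1 + N) := fun k => by
    have h1 := hv (k + N)
    have h2 := mul_le_mul_of_nonneg_right (hN (k + N) (Nat.le_add_left _ _)).le
      (mul_nonneg (hγ (k + N)) (sq_nonneg (D (k + N))))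
    rw [add_right_comm]
    linarith
  refine summable_of_sum_range_le (c := (v N - B) / (c / 2))
    (fun k => mul_nonneg (hγ _) (sq_nonneg _)) fun p => ?_
  rw [le_div_iff₀ (half_pos hc), mul_comm, Finset.mul_sum]
  refine (Finset.sum_le_sum fun k _ => hdec k).trans ?_
  rw [Finset.sum_range_sub' (fun k => v (k + N))]
  have := hB (p + N)
  simp only [zero_add]
  linarith

/-! ### Lagrange multipliers of convex problems -/

namespace OptProblem

variable {E J M : Type*} [NormedAddCommGroup E] [InnerProductSpace ℝ E] [Fintype J] [Fintype M]

theorem exists_hasFDerivAt_constraint (Q : OptProblem E J M) {x : E}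
    (hg : DifferentiableAt ℝ Q.g x) (hh : DifferentiableAt ℝ Q.h x) (μ : J → ℝ) (lam : M → ℝ) :
    ∃ φ' : E →L[ℝ] ℝ,
      HasFDerivAt (fun z => (∑ j, μ j * Q.g z j) + ∑ l, lam l * Q.h z l) φ' x ∧
        ∀ v, φ' v = Q.constraintDeriv x μ lam v := by
  have h1 := hasFDerivAt_pi'.1 hg.hasFDerivAt
  have h2 := hasFDerivAt_pi'.1 hh.hasFDerivAt
  refine ⟨_, (HasFDerivAt.fun_sum fun j _ => (h1 j).const_mul (μ j)).add
    (HasFDerivAt.fun_sum fun l _ => (h2 l).const_mul (lam l)), fun v => ?_⟩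
  simp [constraintDeriv]

/-- A convex problem with a regular point has Lagrange multipliers at each of its optimal
points. -/
theorem IsOptimal.exists_multipliers {Q : OptProblem E J M} {y z : E} (hz : Q.IsOptimal z)
    (hX : Convex ℝ Q.X) (hf : ConvexOn ℝ Q.X Q.f) (hg : ∀ j, ConvexOn ℝ Q.X (fun x => Q.g x j))
    (hh : ∀ x y : E, ∀ a b : ℝ, a + b = 1 → ∀ l,
      Q.h (a • x + b • y) l = a * Q.h x l + b * Q.h y l)
    (hy : Q.IsRegular y) (hgd : DifferentiableAt ℝ Q.g y) (hhd : DifferentiableAt ℝ Q.h y) :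
    ∃ (μ : J → ℝ) (lam : M → ℝ), (∀ j, 0 ≤ μ j) ∧ (∀ j, μ j * Q.g z j = 0) ∧
      ∀ x ∈ Q.X, Q.f z ≤ Q.f x + ((∑ j, μ j * Q.g x j) + ∑ l, lam l * Q.h x l) := by
  obtain ⟨τ, μ, lam, hτ, hμ, hne, hineq⟩ := exists_fritzJohn_multipliers hX hf hg hh hz.1.1 hz.1.2.1
    hz.1.2.2 fun x hx hgx hhx => hz.2 x ⟨hx, hgx, hhx⟩
  -- With `τ = 0`, the inequality at `y` forces complementarity there, so `y` minimizes the weighted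
  -- constraints over `Q.X`. Their first-order condition is exactly what regularity of `y` forbids
  -- for nonzero multipliers. The regular point need not be the optimal one.
  have hpos : 0 < τ := by
    refine hτ.lt_of_ne' fun h0 => hne ⟨h0, ?_⟩
    subst h0
    have hy0 : ∑ l, lam l * Q.h y l = 0 :=
      Finset.sum_eq_zero fun l _ => by rw [hy.1.2.2 l, mul_zero]
    have hterm : ∀ j ∈ Finset.univ, μ j * Q.g y j ≤ 0 := fun j _ =>
      mul_nonpos_of_nonneg_of_nonpos (hμ j) (hy.1.2.1 j)
    have hy1 : ∑ j, μ j * Q.g y j = 0 :=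
      le_antisymm (Finset.sum_nonpos hterm) (by simpa [hy0] using hineq y hy.1.1)
    obtain ⟨φ', hφ', hφ⟩ := Q.exists_hasFDerivAt_constraint hgd hhd μ lam
    refine hy.2 μ lam (fun x' hx' => ?_) hμ fun j hj =>
      (mul_eq_zero.1 ((Finset.sum_eq_zero_iff_of_nonpos hterm).1 hy1 j (Finset.mem_univ j))).resolve_right hj
    rw [← hφ]
    refine IsMinOn.fderiv_nonneg hX hy.1.1 (isMinOn_iff.2 fun x hx => ?_) hφ' hx'
    rw [hy0, hy1, add_zero]
    simpa using hineq x hx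
  have hineq' : ∀ x ∈ Q.X, Q.f z ≤
      Q.f x + ((∑ j, τ⁻¹ * μ j * Q.g x j) + ∑ l, τ⁻¹ * lam l * Q.h x l) := fun x hx => by
    have := mul_nonneg (inv_nonneg.2 hpos.le) (hineq x hx)
    simp only [mul_add, Finset.mul_sum, ← mul_assoc, inv_mul_cancel₀ hpos.ne', one_mul] at this
    linarith
  have hμ' : ∀ j, 0 ≤ τ⁻¹ * μ j := fun j => mul_nonneg (inv_nonneg.2 hpos.le) (hμ j)
  refine ⟨fun j => τ⁻¹ * μ j, fun l => τ⁻¹ * lam l, hμ', fun j => ?_, hineq'⟩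
  have hterm : ∀ j ∈ Finset.univ, τ⁻¹ * μ j * Q.g z j ≤ 0 := fun j _ =>
    mul_nonpos_of_nonneg_of_nonpos (hμ' j) (hz.1.2.1 j)
  have hz0 : ∑ l, τ⁻¹ * lam l * Q.h z l = 0 :=
    Finset.sum_eq_zero fun l _ => by rw [hz.1.2.2 l, mul_zero]
  -- Testing the inequality at `z` itself bounds a sum of nonpositive terms below by zero, so each
  -- of them vanishes.
  have hz1 := hineq' z hz.1.1
  rw [hz0] at hz1
  exact (Finset.sum_eq_zero_iff_of_nonpos hterm).1
    (le_antisymm (Finset.sum_nonpos hterm) (by linarith)) j (Finset.mem_univ j)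

/-- A feasible point minimizing the Lagrangian satisfies the Karush-Kuhn-Tucker conditions. -/
theorem isKKT_of_forall_le {Q : OptProblem E J M} {z : E} (hX : Convex ℝ Q.X)
    (hz : z ∈ Q.feasible) (hfd : DifferentiableAt ℝ Q.f z) (hgd : DifferentiableAt ℝ Q.g z)
    (hhd : DifferentiableAt ℝ Q.h z) {μ : J → ℝ} {lam : M → ℝ} (hμ : ∀ j, 0 ≤ μ j)
    (hcomp : ∀ j, μ j * Q.g z j = 0)
    (hmin : ∀ x ∈ Q.X, Q.f z ≤ Q.f x + ((∑ j, μ j * Q.g x j) + ∑ l, lam l * Q.h x l)) :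
    Q.IsKKT z μ lam := by
  refine ⟨fun x' hx' => ?_, hcomp, hμ, hz⟩
  obtain ⟨φ', hφ', hφ⟩ := Q.exists_hasFDerivAt_constraint hgd hhd μ lam
  have := IsMinOn.fderiv_nonneg hX hz.1 (isMinOn_iff.2 fun x hx => ?_)
    (hfd.hasFDerivAt.add hφ') hx'
  · simpa [hφ] using this
  · have h0 : ∑ l, lam l * Q.h z l = 0 :=
      Finset.sum_eq_zero fun l _ => by rw [hz.2.2 l, mul_zero]
    have h1 : ∑ j, μ j * Q.g z j = 0 := Finset.sum_eq_zero fun j _ => hcomp j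
    simp only [Pi.add_apply]
    rw [h0, h1]
    simpa using hmin x hx

end OptProblem

namespace OptProblem

theorem isClosed_feasible {E J M : Type*} [TopologicalSpace E] {Q : OptProblem E J M}
    (hX : IsClosed Q.X) (hg : ContinuousOn Q.g Q.X) (hh : Continuous Q.h) :
    IsClosed Q.feasible := by
  have h1 := hg.preimage_isClosed_of_isClosed hX (isClosed_Iic (a := (0 : J → ℝ)))
  have h2 := (isClosed_singleton (x := (0 : M → ℝ))).preimage hh
  convert h1.inter h2 using 1
  ext x
  simp only [feasible, Set.mem_ofPred_eq, Set.mem_inter_iff, Set.mem_preimage, Set.mem_Iic,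
    Set.mem_singleton_iff, funext_iff, Pi.le_def, Pi.zero_apply, and_assoc]

theorem convex_feasible {E J M : Type*} [AddCommGroup E] [Module ℝ E] {Q : OptProblem E J M}
    (hX : Convex ℝ Q.X) (hg : ∀ j, ConvexOn ℝ Q.X (fun x => Q.g x j))
    (hh : ∀ x y : E, ∀ a b : ℝ, a + b = 1 → ∀ l,
      Q.h (a • x + b • y) l = a * Q.h x l + b * Q.h y l) : Convex ℝ Q.feasible := by
  intro x hx y hy a b ha hb hab
  refine ⟨hX hx.1 hy.1 ha hb hab, fun j => ?_, fun l => by simp [hh x y a b hab, hx.2.2, hy.2.2]⟩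
  have h1 := (hg j).2 hx.1 hy.1 ha hb hab
  simp only [smul_eq_mul] at h1
  have h2 := mul_nonpos_of_nonneg_of_nonpos ha (hx.2.1 j)
  have h3 := mul_nonpos_of_nonneg_of_nonpos hb (hy.2.1 j)
  linarith

end OptProblem

/-! ### Blockwise calculus for the coupled problem -/

namespace SDDProblem

variable {I : ℕ} {n r : Fin I → ℕ} {rt m : ℕ}

theorem problem_f_apply (Q : SDDProblem I n r rt m) (x : BlockSpace I n) :
    Q.problem.f x = ∑ i, Q.f i (x i) := rfl

theorem problem_g_inl (Q : SDDProblem I n r rt m) (x : BlockSpace I n) (j : Fin rt) :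
    Q.problem.g x (Sum.inl j) = ∑ i, Q.gt i (x i) j := rfl

theorem problem_g_inr (Q : SDDProblem I n r rt m) (x : BlockSpace I n)
    (p : Σ i : Fin I, Fin (r i)) : Q.problem.g x (Sum.inr p) = Q.g p.1 (x p.1) p.2 := rfl

theorem problem_h_apply (Q : SDDProblem I n r rt m) (x : BlockSpace I n) (l : Fin m) :
    Q.problem.h x l = (∑ i, ∑ k, Q.A i l k * x i k) + Q.b l := by
  simp [problem, Matrix.mulVec, dotProduct, Finset.sum_apply]

theorem mem_problem_X (Q : SDDProblem I n r rt m) (x : BlockSpace I n) :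
    x ∈ Q.problem.X ↔ ∀ i, x i ∈ Q.X i := Iff.rfl

theorem hasFDerivAt_block {F : Type*} [NormedAddCommGroup F] [NormedSpace ℝ F] {i : Fin I}
    {φ : EuclideanSpace ℝ (Fin (n i)) → F} {x : BlockSpace I n}
    (h : DifferentiableAt ℝ φ (x i)) :
    HasFDerivAt (fun z : BlockSpace I n => φ (z i))
      ((fderiv ℝ φ (x i)).comp
        (PiLp.proj 2 (fun i : Fin I => EuclideanSpace ℝ (Fin (n i))) i)) x :=
  h.hasFDerivAt.comp x (PiLp.hasFDerivAt_apply (𝕜 := ℝ) 2 x i)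

theorem hasFDerivAt_problem_f (Q : SDDProblem I n r rt m) {x : BlockSpace I n}
    (h : ∀ i, DifferentiableAt ℝ (Q.f i) (x i)) :
    HasFDerivAt Q.problem.f (∑ i, (fderiv ℝ (Q.f i) (x i)).comp
        (PiLp.proj 2 (fun i : Fin I => EuclideanSpace ℝ (Fin (n i))) i)) x :=
  HasFDerivAt.fun_sum fun i (_ : i ∈ Finset.univ) => hasFDerivAt_block (h i)

theorem fderiv_problem_f (Q : SDDProblem I n r rt m) {x : BlockSpace I n}
    (h : ∀ i, DifferentiableAt ℝ (Q.f i) (x i)) (v : BlockSpace I n) :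
    fderiv ℝ Q.problem.f x v = ∑ i, fderiv ℝ (Q.f i) (x i) (v i) := by
  rw [(Q.hasFDerivAt_problem_f h).fderiv]
  simp

theorem differentiableAt_problem_g (Q : SDDProblem I n r rt m) {x : BlockSpace I n}
    (h : ∀ i, DifferentiableAt ℝ (Q.gt i) (x i)) (h' : ∀ i, DifferentiableAt ℝ (Q.g i) (x i)) :
    DifferentiableAt ℝ Q.problem.g x := by
  refine differentiableAt_pi.2 fun j => ?_
  rcases j with j | p
  · simp only [problem_g_inl]
    exact DifferentiableAt.fun_sum fun i _ =>
      differentiableAt_pi.1 (hasFDerivAt_block (h i)).differentiableAt j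
  · simp only [problem_g_inr]
    exact differentiableAt_pi.1 (hasFDerivAt_block (h' p.1)).differentiableAt p.2

theorem fderiv_problem_g_inl (Q : SDDProblem I n r rt m) {x : BlockSpace I n}
    (h : ∀ i, DifferentiableAt ℝ (Q.gt i) (x i)) (h' : ∀ i, DifferentiableAt ℝ (Q.g i) (x i))
    (v : BlockSpace I n) (j : Fin rt) :
    fderiv ℝ Q.problem.g x v (Sum.inl j) = ∑ i, fderiv ℝ (Q.gt i) (x i) (v i) j := by
  have h1 := hasFDerivAt_pi'.1 (Q.differentiableAt_problem_g h h').hasFDerivAt (Sum.inl j)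
  have h2 : HasFDerivAt (fun z => Q.problem.g z (Sum.inl j)) _ x :=
    HasFDerivAt.fun_sum fun i (_ : i ∈ Finset.univ) => hasFDerivAt_pi'.1 (hasFDerivAt_block (h i)) j
  simpa using congrArg (fun l => l v) (h1.unique h2)

theorem fderiv_problem_g_inr (Q : SDDProblem I n r rt m) {x : BlockSpace I n}
    (h : ∀ i, DifferentiableAt ℝ (Q.gt i) (x i)) (h' : ∀ i, DifferentiableAt ℝ (Q.g i) (x i))
    (v : BlockSpace I n) (p : Σ i : Fin I, Fin (r i)) :
    fderiv ℝ Q.problem.g x v (Sum.inr p) = fderiv ℝ (Q.g p.1) (x p.1) (v p.1) p.2 := by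
  have h1 := hasFDerivAt_pi'.1 (Q.differentiableAt_problem_g h h').hasFDerivAt (Sum.inr p)
  have h2 : HasFDerivAt (fun z => Q.problem.g z (Sum.inr p)) _ x :=
    hasFDerivAt_pi'.1 (hasFDerivAt_block (h' p.1)) p.2
  simpa using congrArg (fun l => l v) (h1.unique h2)

theorem hasFDerivAt_problem_h (Q : SDDProblem I n r rt m) (x : BlockSpace I n) :
    ∃ L : BlockSpace I n →L[ℝ] (Fin m → ℝ), HasFDerivAt Q.problem.h L x ∧
      ∀ v l, L v l = ∑ i, ∑ k, Q.A i l k * v i k := by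
  let L : BlockSpace I n →L[ℝ] (Fin m → ℝ) := LinearMap.toContinuousLinearMap
    { toFun := fun v l => ∑ i, ∑ k, Q.A i l k * v i k
      map_add' := fun u v => by
        ext l
        simp [mul_add, Finset.sum_add_distrib]
      map_smul' := fun a v => by
        ext l
        simp [Finset.mul_sum, mul_left_comm] }
  refine ⟨L, ?_, fun v l => rfl⟩
  have : Q.problem.h = fun z => L z + Q.b := by
    ext z l
    rw [problem_h_apply]
    rfl
  rw [this]
  exact L.hasFDerivAt.add_const _

theorem differentiableAt_problem_h (Q : SDDProblem I n r rt m) (x : BlockSpace I n) :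
    DifferentiableAt ℝ Q.problem.h x :=
  let ⟨_, h, _⟩ := Q.hasFDerivAt_problem_h x
  h.differentiableAt

theorem fderiv_problem_h (Q : SDDProblem I n r rt m) (x v : BlockSpace I n) (l : Fin m) :
    fderiv ℝ Q.problem.h x v l = ∑ i, ∑ k, Q.A i l k * v i k := by
  obtain ⟨L, h, hL⟩ := Q.hasFDerivAt_problem_h x
  rw [h.fderiv, hL]

theorem problem_h_combo (Q : SDDProblem I n r rt m) (x y : BlockSpace I n) (a b : ℝ)
    (hab : a + b = 1) (l : Fin m) :
    Q.problem.h (a • x + b • y) l = a * Q.problem.h x l + b * Q.problem.h y l := by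
  have hb : Q.b l = a * Q.b l + b * Q.b l := by rw [← add_mul, hab, one_mul]
  simp only [problem_h_apply, PiLp.add_apply, PiLp.smul_apply, smul_eq_mul, mul_add,
    Finset.sum_add_distrib, Finset.mul_sum]
  nth_rw 1 [hb]
  simp only [mul_left_comm]
  ring

theorem convex_problem_X {Q : SDDProblem I n r rt m} (hX : ∀ i, Convex ℝ (Q.X i)) :
    Convex ℝ Q.problem.X :=
  fun _ hx _ hy _ _ ha hb hab i => hX i (hx i) (hy i) ha hb hab

theorem isClosed_problem_X {Q : SDDProblem I n r rt m} (hX : ∀ i, IsClosed (Q.X i)) :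
    IsClosed Q.problem.X := by
  have : Q.problem.X = ⋂ i, (fun x : BlockSpace I n => x i) ⁻¹' Q.X i := by
    ext x
    simp [mem_problem_X]
  rw [this]
  exact isClosed_iInter fun i => (hX i).preimage (PiLp.continuous_apply 2 _ i)

theorem _root_.ConvexOn.comp_block {i : Fin I} {X : Set (EuclideanSpace ℝ (Fin (n i)))}
    {φ : EuclideanSpace ℝ (Fin (n i)) → ℝ} (h : ConvexOn ℝ X φ) {T : Set (BlockSpace I n)}
    (hT : Convex ℝ T) (hTX : ∀ x ∈ T, x i ∈ X) :
    ConvexOn ℝ T (fun x => φ (x i)) :=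
  ⟨hT, fun _ hx _ hy _ _ ha hb hab => h.2 (hTX _ hx) (hTX _ hy) ha hb hab⟩

theorem convexOn_problem_g {Q : SDDProblem I n r rt m} (hX : ∀ i, Convex ℝ (Q.X i))
    (hgt : ∀ i j, ConvexOn ℝ (Q.X i) (fun x => Q.gt i x j))
    (hg : ∀ i j, ConvexOn ℝ (Q.X i) (fun x => Q.g i x j)) (j : Fin rt ⊕ (Σ i : Fin I, Fin (r i))) :
    ConvexOn ℝ Q.problem.X (fun x => Q.problem.g x j) := by
  have hc := convex_problem_X hX
  rcases j with j | p
  · simp only [problem_g_inl]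
    refine ⟨hc, fun x hx y hy a b ha hb hab => ?_⟩
    rw [smul_eq_mul, smul_eq_mul, Finset.mul_sum, Finset.mul_sum, ← Finset.sum_add_distrib]
    exact Finset.sum_le_sum fun i _ => (hgt i j).2 (hx i) (hy i) ha hb hab
  · exact (hg p.1 p.2).comp_block hc fun x hx => hx p.1

theorem continuousOn_block {F : Type*} [TopologicalSpace F] {Q : SDDProblem I n r rt m} {i : Fin I}
    {φ : EuclideanSpace ℝ (Fin (n i)) → F} (h : ContinuousOn φ (Q.X i)) :
    ContinuousOn (fun x : BlockSpace I n => φ (x i)) Q.problem.X :=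
  h.comp (PiLp.continuous_apply 2 _ i).continuousOn fun _ hx => hx i

theorem continuousOn_problem_f {Q : SDDProblem I n r rt m}
    (h : ∀ i, ContinuousOn (Q.f i) (Q.X i)) : ContinuousOn Q.problem.f Q.problem.X :=
  continuousOn_finsetSum Finset.univ fun i _ => continuousOn_block (h i)

theorem continuousOn_problem_g {Q : SDDProblem I n r rt m}
    (h : ∀ i, ContinuousOn (Q.gt i) (Q.X i)) (h' : ∀ i, ContinuousOn (Q.g i) (Q.X i)) :
    ContinuousOn Q.problem.g Q.problem.X := by
  refine continuousOn_pi.2 fun j => ?_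
  rcases j with j | p
  · exact continuousOn_finsetSum Finset.univ fun i _ => continuousOn_pi.1
      (continuousOn_block (h i)) j
  · exact continuousOn_pi.1 (continuousOn_block (h' p.1)) p.2

theorem continuous_problem_h (Q : SDDProblem I n r rt m) : Continuous Q.problem.h :=
  continuous_iff_continuousAt.2 fun x => (Q.differentiableAt_problem_h x).continuousAt

/-! ### Strong duality for the partial Lagrangian -/

theorem lagrangian_eq (Q : SDDProblem I n r rt m) (μ : Fin rt → ℝ) (lam : Fin m → ℝ)
    (x : BlockSpace I n) : Q.lagrangian μ lam x = Q.problem.f x +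
      ((∑ j, μ j * Q.problem.g x (Sum.inl j)) + ∑ l, lam l * Q.problem.h x l) := by
  simp only [lagrangian, lagrangianBlock, problem_f_apply, problem_g_inl, problem_h_apply,
    dotProduct, Matrix.mulVec, Finset.sum_add_distrib, Finset.mul_sum, mul_add]
  rw [Finset.sum_comm (γ := Fin rt), Finset.sum_comm (γ := Fin m)]
  ring

/-- The constraint set of the dual subproblems. -/
def localSet (Q : SDDProblem I n r rt m) : Set (BlockSpace I n) :=
  {x | ∀ i, x i ∈ Q.X i ∧ ∀ j, Q.g i (x i) j ≤ 0}

/-- Relaxing the coupling constraints leaves a sum over blocks on a product set, so minimizing each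
block separately minimizes the whole. -/
theorem isMinOn_lagrangian {Q : SDDProblem I n r rt m} {μ : Fin rt → ℝ} {lam : Fin m → ℝ}
    {xs : BlockSpace I n} (h : ∀ i, (Q.subproblem μ lam i).IsOptimal (xs i)) :
    IsMinOn (Q.lagrangian μ lam) Q.localSet xs := by
  refine isMinOn_iff.2 fun x hx => ?_
  unfold lagrangian
  gcongr with i
  exact (h i).2 (x i) ⟨(hx i).1, (hx i).2, fun l => l.elim⟩

/-- Strong duality: the minimizer of the partial Lagrangian at a dual optimal point solves the
problem. -/
theorem eq_of_isMasterOptimal {Q : SDDProblem I n r rt m} (hX : ∀ i, Convex ℝ (Q.X i))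
    (hgt : ∀ i j, ConvexOn ℝ (Q.X i) (fun x => Q.gt i x j))
    (hg : ∀ i j, ConvexOn ℝ (Q.X i) (fun x => Q.g i x j))
    (hf : StrictConvexOn ℝ Q.problem.X Q.problem.f) {z : BlockSpace I n}
    (hz : z ∈ Q.problem.feasible) {ν : Fin rt ⊕ (Σ i : Fin I, Fin (r i)) → ℝ}
    {κ : Fin m → ℝ} (hν : ∀ j, 0 ≤ ν j)
    (hmin : ∀ x ∈ Q.problem.X, Q.problem.f z ≤
      Q.problem.f x + ((∑ j, ν j * Q.problem.g x j) + ∑ l, κ l * Q.problem.h x l))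
    {μ : Fin rt → ℝ} {lam : Fin m → ℝ} (hmaster : Q.IsMasterOptimal μ lam)
    {xs : BlockSpace I n} (hxs : ∀ i, (Q.subproblem μ lam i).IsOptimal (xs i)) : xs = z := by
  have hY : Q.localSet ⊆ Q.problem.X := fun x hx i => (hx i).1
  have hYc : Convex ℝ Q.localSet := fun x hx y hy a b ha hb hab i => by
    refine ⟨hX i (hx i).1 (hy i).1 ha hb hab, fun j => ?_⟩
    have h1 := (hg i j).2 (hx i).1 (hy i).1 ha hb hab
    have h2 := mul_nonpos_of_nonneg_of_nonpos ha ((hx i).2 j)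
    have h3 := mul_nonpos_of_nonneg_of_nonpos hb ((hy i).2 j)
    simp only [smul_eq_mul] at h1
    simp only [PiLp.add_apply, PiLp.smul_apply]
    linarith
  have hzY : z ∈ Q.localSet := fun i => ⟨hz.1 i, fun j => hz.2.1 (Sum.inr ⟨i, j⟩)⟩
  have hxsY : xs ∈ Q.localSet := fun i => ⟨(hxs i).1.1, (hxs i).1.2.1⟩
  -- The full multipliers also price the local constraints. On `localSet` those terms are
  -- nonpositive, so dropping them keeps the lower bound `f z`.
  have hdual : (Q.problem.f z : EReal) ≤ Q.dualFunction (fun j => ν (Sum.inl j)) κ := by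
    refine le_iInf₂ fun x hx => EReal.coe_le_coe_iff.2 ?_
    rw [lagrangian_eq]
    have h1 := hmin x (hY hx)
    rw [Fintype.sum_sum_type] at h1
    have h2 : ∑ p : Σ i : Fin I, Fin (r i), ν (Sum.inr p) * Q.problem.g x (Sum.inr p) ≤ 0 :=
      Finset.sum_nonpos fun p _ => mul_nonpos_of_nonneg_of_nonpos (hν _) ((hx p.1).2 p.2)
    linarith
  have hlow : ∀ x ∈ Q.localSet, Q.problem.f z ≤ Q.lagrangian μ lam x := fun x hx =>
    EReal.coe_le_coe_iff.1 ((hdual.trans (hmaster.2 _ κ fun j => hν _)).trans (iInf₂_le x hx))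
  -- Feasibility of `z` gives `lagrangian z ≤ f z`, and `hlow` bounds the Lagrangian below by `f z`,
  -- so `z` is also a minimizer. Strict convexity then identifies it with `xs`, whose coupled
  -- feasibility was not known beforehand.
  have hzmin : IsMinOn (Q.lagrangian μ lam) Q.localSet z := by
    refine isMinOn_iff.2 fun x hx => le_trans ?_ (hlow x hx)
    rw [lagrangian_eq]
    have h1 : ∑ j, μ j * Q.problem.g z (Sum.inl j) ≤ 0 :=
      Finset.sum_nonpos fun j _ => mul_nonpos_of_nonneg_of_nonpos (hmaster.1 j) (hz.2.1 _)
    have h2 : ∑ l, lam l * Q.problem.h z l = 0 :=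
      Finset.sum_eq_zero fun l _ => by rw [hz.2.2 l, mul_zero]
    linarith
  have hconv : ConvexOn ℝ Q.localSet (fun x =>
      (∑ j, μ j * Q.problem.g x (Sum.inl j)) + ∑ l, lam l * Q.problem.h x l) := by
    refine ⟨hYc, fun x hx y hy a b ha hb hab => ?_⟩
    simp only [smul_eq_mul, mul_add, Finset.mul_sum, Q.problem_h_combo x y a b hab]
    rw [add_add_add_comm, ← Finset.sum_add_distrib, ← Finset.sum_add_distrib]
    refine add_le_add (Finset.sum_le_sum fun j _ => ?_)
      (Finset.sum_le_sum fun l _ => le_of_eq (by ring))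
    have := mul_le_mul_of_nonneg_left
      ((convexOn_problem_g hX hgt hg (Sum.inl j)).2 (hY hx) (hY hy) ha hb hab) (hmaster.1 j)
    simp only [smul_eq_mul] at this
    linarith
  have := (hf.subset hY hYc).add_convexOn hconv
  have hL : StrictConvexOn ℝ Q.localSet (Q.lagrangian μ lam) :=
    this.congr fun x _ => (Q.lagrangian_eq μ lam x).symm
  exact hL.eq_of_isMinOn (isMinOn_lagrangian hxs) hzmin hxsY hzY

end SDDProblem

/-! ### Quadratic bounds for the surrogates and the objective -/

theorem ContDiffOn.differentiableAt_of_subset {E G : Type*} [NormedAddCommGroup E]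
    [NormedSpace ℝ E] [NormedAddCommGroup G] [NormedSpace ℝ G] {U X : Set E} {φ : E → G}
    (h : ContDiffOn ℝ 1 φ U) (hU : IsOpen U) (hXU : X ⊆ U) {u : E} (hu : u ∈ X) :
    DifferentiableAt ℝ φ u :=
  (h.differentiableOn one_ne_zero).differentiableAt (hU.mem_nhds (hXU hu))

section Bounds

variable {E : Type*} [NormedAddCommGroup E] [InnerProductSpace ℝ E] [CompleteSpace E]
  {U X : Set E} {f : E → ℝ} {F : E → E → ℝ}

/-- Strong monotonicity of the gradient, integrated along a segment, gives half its modulus as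
constant, independent of `y`. -/
theorem IsObjectiveSurrogate.exists_quadratic_lower_bound (h : IsObjectiveSurrogate U X f F)
    (hU : IsOpen U) (hXU : X ⊆ U) (hX : Convex ℝ X) :
    ∃ c : ℝ, 0 < c ∧ ∀ y ∈ X, ∀ u ∈ X, ∀ v ∈ X,
      F u y + fderiv ℝ (fun z => F z y) u (v - u) + c * ‖v - u‖ ^ 2 ≤ F v y := by
  obtain ⟨c, hc, hmono⟩ := h.strongConvex
  refine ⟨c / 2, half_pos hc, fun y hy u hu v hv => ?_⟩
  have := add_fderiv_add_le_of_forall_segment (f := fun z => F z y) (u := u) (v := v)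
    (C := c * ‖v - u‖ ^ 2)
    (fun t ht => (h.contDiff y hy).differentiableAt_of_subset hU hXU (hX.add_smul_sub_mem hu hv ht))
    fun t ht => ?_
  · linarith
  -- Monotonicity is tested against `t • (v - u)` and a factor `t` is cancelled, hence the separate
  -- case `t = 0`.
  · rcases ht.1.eq_or_lt with rfl | hpos
    · simp
    · have h1 := hmono _ (hX.add_smul_sub_mem hu hv ht) u hu y hy
      rw [add_sub_cancel_left, norm_smul, Real.norm_of_nonneg ht.1, real_inner_smul_left,
        inner_sub_right, real_inner_comm, inner_gradient_left, real_inner_comm,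
        inner_gradient_left] at h1
      have h2 : t * (c * ‖v - u‖ ^ 2 * t) ≤
          t * (fderiv ℝ (fun z => F z y) (u + t • (v - u)) (v - u) -
            fderiv ℝ (fun z => F z y) u (v - u)) := by
        linarith
      linarith [le_of_mul_le_mul_left h2 hpos]

/-- The segment estimate applied to `-f` with a negative constant. It yields `K / 2`, which is
relaxed to `K`. -/
theorem LipschitzOnWith.le_quadratic_upper_bound {K : NNReal}
    (hK : LipschitzOnWith K (gradient f) X) (hX : Convex ℝ X)
    (hf : ∀ u ∈ X, DifferentiableAt ℝ f u) {u v : E} (hu : u ∈ X) (hv : v ∈ X) :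
    f v ≤ f u + fderiv ℝ f u (v - u) + K * ‖v - u‖ ^ 2 := by
  have := add_fderiv_add_le_of_forall_segment (f := -f) (u := u) (v := v)
    (C := -(K * ‖v - u‖ ^ 2)) (fun t ht => (hf _ (hX.add_smul_sub_mem hu hv ht)).neg)
    fun t ht => ?_
  · rw [fderiv_neg] at this
    simp only [Pi.neg_apply, neg_apply] at this
    have h0 : 0 ≤ K * ‖v - u‖ ^ 2 := by positivity
    linarith
  · rw [fderiv_neg, fderiv_neg]
    simp only [neg_apply]
    have h1 := hK.norm_sub_le (hX.add_smul_sub_mem hu hv ht) hu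
    rw [add_sub_cancel_left, norm_smul, Real.norm_of_nonneg ht.1] at h1
    have h2 := (real_inner_le_norm (gradient f (u + t • (v - u)) - gradient f u) (v - u)).trans
      (mul_le_mul_of_nonneg_right h1 (norm_nonneg _))
    rw [inner_sub_left, inner_gradient_left, inner_gradient_left] at h2
    linarith

end Bounds

theorem IsConstraintSurrogate.continuousOn_left {E J : Type*} [NormedAddCommGroup E]
    [InnerProductSpace ℝ E] [Fintype J] {X : Set E} {g : E → J → ℝ} {G : E → E → J → ℝ}
    (h : IsConstraintSurrogate X g G) {y : E} (hy : y ∈ X) :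
    ContinuousOn (fun x => G x y) X :=
  fun x hx => (h.differentiable x hx y hy).continuousAt.continuousWithinAt

namespace SDDProblem

variable {I : ℕ} {n r : Fin I → ℕ} {rt m : ℕ} {P : SDDProblem I n r rt m}
  {S : SDDSurrogate I n r rt}

theorem exists_quadratic_lower_bound (hP : P.Assumptions) (hS : P.SurrogateAssumptions S) :
    ∃ c : ℝ, 0 < c ∧ ∀ y ∈ P.problem.X, ∀ u ∈ P.problem.X, ∀ v ∈ P.problem.X,
      (P.approx S y).problem.f u + fderiv ℝ (P.approx S y).problem.f u (v - u) + c * ‖v - u‖ ^ 2 ≤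
        (P.approx S y).problem.f v := by
  choose c hc hcb using fun i => (hS.F_surrogate i).exists_quadratic_lower_bound (hP.U_open i)
    (hP.X_subset_U i) (hP.X_convex i)
  -- Any sufficiently small positive number lies below the finitely many `c i`; this also covers the
  -- case of no blocks.
  obtain ⟨c₀, hc₀, hle⟩ : ∃ c₀ : ℝ, 0 < c₀ ∧ ∀ i, c₀ ≤ c i := by
    have h1 : ∀ᶠ t in nhdsWithin (0 : ℝ) (Set.Ioi 0), ∀ i, t ≤ c i :=
      Filter.eventually_all.2 fun i =>
        nhdsWithin_le_nhds ((eventually_lt_nhds (hc i)).mono fun _ h => h.le)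
    obtain ⟨t, ht, ht0⟩ := (h1.and self_mem_nhdsWithin).exists
    exact ⟨t, ht0, ht⟩
  refine ⟨c₀, hc₀, fun y hy u hu v hv => ?_⟩
  rw [fderiv_problem_f _ fun i => ((hS.F_surrogate i).contDiff (y i) (hy i)).differentiableAt_of_subset
    (hP.U_open i) (hP.X_subset_U i) (hu i), PiLp.norm_sq_eq_of_L2, Finset.mul_sum,
    problem_f_apply, problem_f_apply, ← Finset.sum_add_distrib, ← Finset.sum_add_distrib]
  refine Finset.sum_le_sum fun i _ => le_trans ?_ (hcb i (y i) (hy i) (u i) (hu i) (v i) (hv i))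
  simp only [PiLp.sub_apply]
  exact add_le_add le_rfl (mul_le_mul_of_nonneg_right (hle i) (sq_nonneg _))

theorem exists_quadratic_upper_bound (hP : P.Assumptions) :
    ∃ L : ℝ, ∀ u ∈ P.problem.X, ∀ v ∈ P.problem.X,
      P.problem.f v ≤ P.problem.f u + fderiv ℝ P.problem.f u (v - u) + L * ‖v - u‖ ^ 2 := by
  choose K hK using hP.f_lipschitz
  have hd : ∀ i, ∀ u ∈ P.X i, DifferentiableAt ℝ (P.f i) u := fun i u hu =>
    (hP.f_contDiff i).differentiableAt_of_subset (hP.U_open i) (hP.X_subset_U i) hu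
  refine ⟨∑ i, (K i : ℝ), fun u hu v hv => ?_⟩
  rw [fderiv_problem_f _ fun i => hd i _ (hu i), PiLp.norm_sq_eq_of_L2, Finset.mul_sum,
    problem_f_apply, problem_f_apply, ← Finset.sum_add_distrib, ← Finset.sum_add_distrib]
  refine Finset.sum_le_sum fun i _ =>
    ((hK i).le_quadratic_upper_bound (hP.X_convex i) (hd i) (hu i) (hv i)).trans ?_
  simp only [PiLp.sub_apply]
  exact add_le_add le_rfl (mul_le_mul_of_nonneg_right
    (Finset.single_le_sum (f := fun i => (K i : ℝ)) (fun i _ => NNReal.coe_nonneg _)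
      (Finset.mem_univ i)) (sq_nonneg _))

/-! ### The convex approximate problem at a point -/

section Approx

variable {y : BlockSpace I n}

theorem approx_f_differentiableAt (hP : P.Assumptions) (hS : P.SurrogateAssumptions S)
    (hy : y ∈ P.problem.X) {u : BlockSpace I n} (hu : u ∈ P.problem.X) (i : Fin I) :
    DifferentiableAt ℝ ((P.approx S y).f i) (u i) :=
  ((hS.F_surrogate i).contDiff (y i) (hy i)).differentiableAt_of_subset (hP.U_open i)
    (hP.X_subset_U i) (hu i)

theorem approx_gt_differentiableAt (hS : P.SurrogateAssumptions S)
    (hy : y ∈ P.problem.X) {u : BlockSpace I n} (hu : u ∈ P.problem.X) (i : Fin I) :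
    DifferentiableAt ℝ ((P.approx S y).gt i) (u i) :=
  (hS.Gt_surrogate i).differentiable _ (hu i) _ (hy i)

theorem approx_g_differentiableAt (hS : P.SurrogateAssumptions S)
    (hy : y ∈ P.problem.X) {u : BlockSpace I n} (hu : u ∈ P.problem.X) (i : Fin I) :
    DifferentiableAt ℝ ((P.approx S y).g i) (u i) :=
  (hS.G_surrogate i).differentiable _ (hu i) _ (hy i)

theorem approx_g_self (hS : P.SurrogateAssumptions S) (hy : y ∈ P.problem.X) :
    (P.approx S y).problem.g y = P.problem.g y := by
  ext j
  rcases j with j | p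
  · exact Finset.sum_congr rfl fun i (_ : i ∈ Finset.univ) => congrFun ((hS.Gt_surrogate i).eq_self _ (hy i)) j
  · exact congrFun ((hS.G_surrogate p.1).eq_self _ (hy p.1)) p.2

theorem le_approx_g (hS : P.SurrogateAssumptions S) (hy : y ∈ P.problem.X) {u : BlockSpace I n}
    (hu : u ∈ P.problem.X) (j : Fin rt ⊕ (Σ i : Fin I, Fin (r i))) :
    P.problem.g u j ≤ (P.approx S y).problem.g u j := by
  rcases j with j | p
  · exact Finset.sum_le_sum fun i (_ : i ∈ Finset.univ) => (hS.Gt_surrogate i).majorant _ (hu i) _ (hy i) j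
  · exact (hS.G_surrogate p.1).majorant _ (hu p.1) _ (hy p.1) p.2

theorem gt_differentiableAt (hP : P.Assumptions) {u : BlockSpace I n} (hu : u ∈ P.problem.X)
    (i : Fin I) : DifferentiableAt ℝ (P.gt i) (u i) :=
  (hP.gt_contDiff i).differentiableAt_of_subset (hP.U_open i) (hP.X_subset_U i) (hu i)

theorem g_differentiableAt (hP : P.Assumptions) {u : BlockSpace I n} (hu : u ∈ P.problem.X)
    (i : Fin I) : DifferentiableAt ℝ (P.g i) (u i) :=
  (hP.g_contDiff i).differentiableAt_of_subset (hP.U_open i) (hP.X_subset_U i) (hu i)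

theorem f_differentiableAt (hP : P.Assumptions) {u : BlockSpace I n} (hu : u ∈ P.problem.X)
    (i : Fin I) : DifferentiableAt ℝ (P.f i) (u i) :=
  (hP.f_contDiff i).differentiableAt_of_subset (hP.U_open i) (hP.X_subset_U i) (hu i)

theorem approx_fderiv_f_self (hP : P.Assumptions) (hS : P.SurrogateAssumptions S)
    (hy : y ∈ P.problem.X) :
    fderiv ℝ (P.approx S y).problem.f y = fderiv ℝ P.problem.f y := by
  ext v
  rw [fderiv_problem_f _ (approx_f_differentiableAt hP hS hy hy),
    fderiv_problem_f _ (f_differentiableAt hP hy)]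
  refine Finset.sum_congr rfl fun i _ => ?_
  rw [← inner_gradient_left, ← inner_gradient_left, ← (hS.F_surrogate i).gradient_eq _ (hy i)]
  rfl

theorem approx_fderiv_g_self (hP : P.Assumptions) (hS : P.SurrogateAssumptions S)
    (hy : y ∈ P.problem.X) :
    fderiv ℝ (P.approx S y).problem.g y = fderiv ℝ P.problem.g y := by
  ext v j
  rcases j with j | p
  · rw [fderiv_problem_g_inl _ (approx_gt_differentiableAt hS hy hy)
        (approx_g_differentiableAt hS hy hy),
      fderiv_problem_g_inl _ (gt_differentiableAt hP hy) (g_differentiableAt hP hy)]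
    refine Finset.sum_congr rfl fun i _ => ?_
    rw [← (hS.Gt_surrogate i).deriv_eq _ (hy i)]
    rfl
  · rw [fderiv_problem_g_inr _ (approx_gt_differentiableAt hS hy hy)
        (approx_g_differentiableAt hS hy hy),
      fderiv_problem_g_inr _ (gt_differentiableAt hP hy) (g_differentiableAt hP hy),
      ← (hS.G_surrogate p.1).deriv_eq _ (hy p.1)]
    rfl

theorem mem_feasible_approx_self (hS : P.SurrogateAssumptions S) (hy : y ∈ P.problem.feasible) :
    y ∈ (P.approx S y).problem.feasible :=
  ⟨hy.1, by rw [approx_g_self hS hy.1]; exact hy.2.1, hy.2.2⟩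

/-- Regularity at `y` depends only on the set `X` and on the values and first derivatives of the
constraints at `y`, all of which are shared by the two problems. -/
theorem isRegular_approx_self (hP : P.Assumptions) (hS : P.SurrogateAssumptions S)
    (hy : P.problem.IsRegular y) : (P.approx S y).problem.IsRegular y := by
  refine ⟨mem_feasible_approx_self hS hy.1, fun μ lam hvar hμ hcomp => ?_⟩
  refine hy.2 μ lam (fun x' hx' => ?_) hμ ?_
  · have := hvar x' hx'
    simp only [OptProblem.constraintDeriv, approx_fderiv_g_self hP hS hy.1.1] at this
    exact this
  · rw [← approx_g_self hS hy.1.1]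
    exact hcomp

theorem convexOn_approx_g (hP : P.Assumptions) (hS : P.SurrogateAssumptions S)
    (hy : y ∈ P.problem.X) (j : Fin rt ⊕ (Σ i : Fin I, Fin (r i))) :
    ConvexOn ℝ (P.approx S y).problem.X (fun x => (P.approx S y).problem.g x j) :=
  convexOn_problem_g (Q := P.approx S y) hP.X_convex
    (fun i => (hS.Gt_surrogate i).convex _ (hy i)) (fun i => (hS.G_surrogate i).convex _ (hy i)) j

theorem convex_feasible_approx (hP : P.Assumptions) (hS : P.SurrogateAssumptions S)
    (hy : y ∈ P.problem.X) : Convex ℝ (P.approx S y).problem.feasible :=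
  OptProblem.convex_feasible (convex_problem_X (Q := P.approx S y) hP.X_convex)
    (convexOn_approx_g hP hS hy) (P.approx S y).problem_h_combo

/-- Majorization makes the approximation an inner one; this is what keeps the iterates feasible. -/
theorem feasible_approx_subset (hS : P.SurrogateAssumptions S) (hy : y ∈ P.problem.X) :
    (P.approx S y).problem.feasible ⊆ P.problem.feasible :=
  fun _ hu => ⟨hu.1, fun j => (le_approx_g hS hy hu.1 j).trans (hu.2.1 j), hu.2.2⟩

theorem isClosed_feasible (hP : P.Assumptions) : IsClosed P.problem.feasible :=
  OptProblem.isClosed_feasible (isClosed_problem_X hP.X_closed)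
    (continuousOn_problem_g (fun i => (hP.gt_contDiff i).continuousOn.mono (hP.X_subset_U i))
      fun i => (hP.g_contDiff i).continuousOn.mono (hP.X_subset_U i)) P.continuous_problem_h

/-- A step of the method: the blockwise dual solutions solve the convex approximate problem and
satisfy its Karush-Kuhn-Tucker conditions. -/
theorem isOptimal_and_isKKT_of_isMasterOptimal (hP : P.Assumptions)
    (hS : P.SurrogateAssumptions S) (hy : P.problem.IsRegular y) {μ : Fin rt → ℝ}
    {lam : Fin m → ℝ} (hmaster : (P.approx S y).IsMasterOptimal μ lam) {xs : BlockSpace I n}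
    (hxs : ∀ i, ((P.approx S y).subproblem μ lam i).IsOptimal (xs i)) :
    (P.approx S y).problem.IsOptimal xs ∧
      ∃ ν κ, (P.approx S y).problem.IsKKT xs ν κ := by
  obtain ⟨c, hc, hquad⟩ := exists_quadratic_lower_bound hP hS
  have hyX := hy.1.1
  have hX : Convex ℝ (P.approx S y).problem.X :=
    convex_problem_X (Q := P.approx S y) hP.X_convex
  have hcl : IsClosed (P.approx S y).problem.feasible :=
    OptProblem.isClosed_feasible (isClosed_problem_X (Q := P.approx S y) hP.X_closed)
      (continuousOn_problem_g (Q := P.approx S y)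
        (fun i => (hS.Gt_surrogate i).continuousOn_left (hyX i))
        fun i => (hS.G_surrogate i).continuousOn_left (hyX i)) (P.approx S y).continuous_problem_h
  have hfc : ContinuousOn (P.approx S y).problem.f (P.approx S y).problem.X :=
    continuousOn_problem_f (Q := P.approx S y) fun i =>
      ((hS.F_surrogate i).contDiff _ (hyX i)).continuousOn.mono (hP.X_subset_U i)
  have hfs : StrictConvexOn ℝ (P.approx S y).problem.X (P.approx S y).problem.f :=
    strictConvexOn_of_quadratic_lower_bound hX hc (fderiv ℝ (P.approx S y).problem.f)
      (hquad y hyX)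
  obtain ⟨z, hz, hzmin⟩ := exists_isMinOn_of_quadratic_growth hcl (hfc.mono fun _ h => h.1)
    (mem_feasible_approx_self hS hy.1) hc (fderiv ℝ (P.approx S y).problem.f y)
    fun v hv => hquad y hyX y hyX v hv.1
  have hzopt : (P.approx S y).problem.IsOptimal z := ⟨hz, isMinOn_iff.1 hzmin⟩
  -- The constraint qualification is used at `y`, where it is inherited, although the multipliers
  -- are those of the solution `z`.
  obtain ⟨ν, κ, hν, hcomp, hmin⟩ := hzopt.exists_multipliers hX hfs.convexOn
    (convexOn_approx_g hP hS hyX) (P.approx S y).problem_h_combo (isRegular_approx_self hP hS hy)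
    ((P.approx S y).differentiableAt_problem_g (approx_gt_differentiableAt hS hyX hyX)
      (approx_g_differentiableAt hS hyX hyX))
    ((P.approx S y).differentiableAt_problem_h y)
  obtain rfl : xs = z := eq_of_isMasterOptimal (Q := P.approx S y) hP.X_convex
    (fun i => (hS.Gt_surrogate i).convex _ (hyX i)) (fun i => (hS.G_surrogate i).convex _ (hyX i))
    hfs hz hν hmin hmaster hxs
  exact ⟨hzopt, ν, κ, OptProblem.isKKT_of_forall_le hX hz
    ((P.approx S y).hasFDerivAt_problem_f
      (approx_f_differentiableAt hP hS hyX hz.1)).differentiableAt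
    ((P.approx S y).differentiableAt_problem_g (approx_gt_differentiableAt hS hyX hz.1)
      (approx_g_differentiableAt hS hyX hz.1))
    ((P.approx S y).differentiableAt_problem_h xs) hν hcomp hmin⟩

/-- The solution of the approximate problem yields a direction of sufficient descent. -/
theorem fderiv_le_of_isOptimal_approx (hP : P.Assumptions) (hS : P.SurrogateAssumptions S)
    {c : ℝ} (hquad : ∀ y ∈ P.problem.X, ∀ u ∈ P.problem.X, ∀ v ∈ P.problem.X,
      (P.approx S y).problem.f u + fderiv ℝ (P.approx S y).problem.f u (v - u) + c * ‖v - u‖ ^ 2 ≤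
        (P.approx S y).problem.f v)
    (hy : y ∈ P.problem.feasible) {xs : BlockSpace I n}
    (hxs : (P.approx S y).problem.IsOptimal xs) :
    fderiv ℝ P.problem.f y (xs - y) ≤ -(c * ‖xs - y‖ ^ 2) := by
  -- The strong convexity bound is taken at the base point `y`, where the surrogate has the true
  -- gradient; `xs` is no worse than `y` for the surrogate, so the slope absorbs the quadratic term.
  have h1 := hquad y hy.1 y hy.1 xs hxs.1.1
  have h2 := hxs.2 y (mem_feasible_approx_self hS hy)
  rw [approx_fderiv_f_self hP hS hy.1] at h1
  linarith

end Approx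

end SDDProblem

/-! ### Passage to the limit and convergence -/

namespace SDDProblem

variable {I : ℕ} {n r : Fin I → ℕ} {rt m : ℕ} {P : SDDProblem I n r rt m}
  {S : SDDSurrogate I n r rt}

theorem tendsto_block {z : BlockSpace I n} {y : ℕ → BlockSpace I n}
    (h : Filter.Tendsto y Filter.atTop (nhds z)) (i : Fin I) :
    Filter.Tendsto (fun k => y k i) Filter.atTop (nhds (z i)) :=
  ((PiLp.continuous_apply 2 _ i).tendsto z).comp h

/-- Both arguments tend to the same point, so limits of surrogate data are diagonal values, where
they agree with the original data. -/
theorem tendsto_of_continuousOn_prod {E F : Type*} [TopologicalSpace E] [TopologicalSpace F]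
    {U X : Set E} {Φ : E × E → F} (hΦ : ContinuousOn Φ (U ×ˢ X)) {z : E} {u y : ℕ → E}
    (hzU : z ∈ U) (hzX : z ∈ X) (huU : ∀ k, u k ∈ U) (hyX : ∀ k, y k ∈ X)
    (hu : Filter.Tendsto u Filter.atTop (nhds z)) (hy : Filter.Tendsto y Filter.atTop (nhds z)) :
    Filter.Tendsto (fun k => Φ (u k, y k)) Filter.atTop (nhds (Φ (z, z))) :=
  (hΦ (z, z) ⟨hzU, hzX⟩).tendsto.comp (tendsto_nhdsWithin_iff.2
    ⟨hu.prodMk_nhds hy, Filter.Eventually.of_forall fun k => ⟨huU k, hyX k⟩⟩)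

/-- Fixed-point principle: if solutions of the approximate problems at `y k` approach `y k` and
`y k → z`, then `z` is a stationary point. -/
theorem isStationary_of_tendsto (hP : P.Assumptions) (hS : P.SurrogateAssumptions S)
    {y u : ℕ → BlockSpace I n} {z : BlockSpace I n} (hz : P.problem.IsRegular z)
    (hyX : ∀ k, y k ∈ P.problem.X)
    (hkkt : ∀ k, ∃ ν κ, (P.approx S (y k)).problem.IsKKT (u k) ν κ)
    (hy : Filter.Tendsto y Filter.atTop (nhds z)) (hu : Filter.Tendsto u Filter.atTop (nhds z)) :
    P.problem.IsStationary z := by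
  have hzX := hz.1.1
  have huX : ∀ k, u k ∈ P.problem.X := fun k => by
    obtain ⟨ν, κ, h⟩ := hkkt k
    exact h.2.2.2.1
  have hfG : ∀ i (v : BlockSpace I n),
      Filter.Tendsto (fun k => fderiv ℝ (fun x => S.Gt i x (y k i)) (u k i) ((v - u k) i))
        Filter.atTop (nhds (fderiv ℝ (P.gt i) (z i) ((v - z) i))) := fun i v => by
    have h1 := tendsto_of_continuousOn_prod (hS.Gt_surrogate i).deriv_continuous (hzX i) (hzX i)
      (fun k => huX k i) (fun k => hyX k i) (tendsto_block hu i) (tendsto_block hy i)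
    rw [(hS.Gt_surrogate i).deriv_eq _ (hzX i)] at h1
    exact (isBoundedBilinearMap_apply.continuous.tendsto _).comp
      (h1.prodMk_nhds (tendsto_block (hu.const_sub v) i))
  have hfg : ∀ i (v : BlockSpace I n),
      Filter.Tendsto (fun k => fderiv ℝ (fun x => S.G i x (y k i)) (u k i) ((v - u k) i))
        Filter.atTop (nhds (fderiv ℝ (P.g i) (z i) ((v - z) i))) := fun i v => by
    have h1 := tendsto_of_continuousOn_prod (hS.G_surrogate i).deriv_continuous (hzX i) (hzX i)
      (fun k => huX k i) (fun k => hyX k i) (tendsto_block hu i) (tendsto_block hy i)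
    rw [(hS.G_surrogate i).deriv_eq _ (hzX i)] at h1
    exact (isBoundedBilinearMap_apply.continuous.tendsto _).comp
      (h1.prodMk_nhds (tendsto_block (hu.const_sub v) i))
  suffices h : ∃ (ν : Fin rt ⊕ (Σ i : Fin I, Fin (r i)) → ℝ) (κ : Fin m → ℝ), (∀ j, 0 ≤ ν j) ∧
      (∀ j, ν j * P.problem.g z j = 0) ∧ ∀ v ∈ P.problem.X, 0 ≤ fderiv ℝ P.problem.f z (v - z) +
        ((∑ j, ν j * fderiv ℝ P.problem.g z (v - z) j) +
          ∑ l, κ l * fderiv ℝ P.problem.h z (v - z) l) by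
    obtain ⟨ν, κ, hν, hcomp, hvar⟩ := h
    exact ⟨ν, κ, hvar, hcomp, hν, hz.1⟩
  refine exists_multipliers_of_tendsto (T := P.problem.X)
    (a := fun k v => fderiv ℝ (P.approx S (y k)).problem.f (u k) (v - u k))
    (b := fun k v j => fderiv ℝ (P.approx S (y k)).problem.g (u k) (v - u k) j)
    (c := fun k v l => fderiv ℝ (P.approx S (y k)).problem.h (u k) (v - u k) l)
    (s := fun k j => (P.approx S (y k)).problem.g (u k) j)
    (a' := fun v => fderiv ℝ P.problem.f z (v - z))
    (b' := fun v j => fderiv ℝ P.problem.g z (v - z) j)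
    (c' := fun v l => fderiv ℝ P.problem.h z (v - z) l)
    (s' := fun j => P.problem.g z j) ?_ ?_ ?_ ?_ ?_ hz.2
  · intro v _
    simp only [fderiv_problem_f _ (approx_f_differentiableAt hP hS (hyX _) (huX _)),
      fderiv_problem_f _ (f_differentiableAt hP hzX)]
    refine tendsto_finsetSum _ fun i _ => ?_
    have h1 := tendsto_of_continuousOn_prod (hS.F_surrogate i).gradient_continuous
      (hP.X_subset_U i (hzX i)) (hzX i) (fun k => hP.X_subset_U i (huX k i)) (fun k => hyX k i)
      (tendsto_block hu i) (tendsto_block hy i)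
    have h2 := h1.inner (𝕜 := ℝ) (tendsto_block (hu.const_sub v) i)
    simp only [(hS.F_surrogate i).gradient_eq _ (hzX i), inner_gradient_left] at h2
    exact h2
  · rintro v _ (j | p)
    · simp only [fderiv_problem_g_inl _ (approx_gt_differentiableAt hS (hyX _) (huX _))
          (approx_g_differentiableAt hS (hyX _) (huX _)),
        fderiv_problem_g_inl _ (gt_differentiableAt hP hzX) (g_differentiableAt hP hzX)]
      exact tendsto_finsetSum _ fun i _ => tendsto_pi_nhds.1 (hfG i v) j
    · simp only [fderiv_problem_g_inr _ (approx_gt_differentiableAt hS (hyX _) (huX _))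
          (approx_g_differentiableAt hS (hyX _) (huX _)),
        fderiv_problem_g_inr _ (gt_differentiableAt hP hzX) (g_differentiableAt hP hzX)]
      exact tendsto_pi_nhds.1 (hfg p.1 v) p.2
  · intro v _ l
    simp only [fderiv_problem_h]
    refine tendsto_finsetSum _ fun i _ => tendsto_finsetSum _ fun k _ => ?_
    exact (((EuclideanSpace.proj (𝕜 := ℝ) k).continuous.tendsto _).comp
      (tendsto_block (hu.const_sub v) i)).const_mul (P.A i l k)
  · rintro (j | p)
    · simp only [problem_g_inl]
      refine tendsto_finsetSum _ fun i _ => tendsto_pi_nhds.1 ?_ j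
      have h1 := tendsto_of_continuousOn_prod (hS.Gt_surrogate i).continuous (hzX i) (hzX i)
        (fun k => huX k i) (fun k => hyX k i) (tendsto_block hu i) (tendsto_block hy i)
      simp only [(hS.Gt_surrogate i).eq_self _ (hzX i)] at h1
      exact h1
    · simp only [problem_g_inr]
      refine tendsto_pi_nhds.1 ?_ p.2
      have h1 := tendsto_of_continuousOn_prod (hS.G_surrogate p.1).continuous (hzX p.1) (hzX p.1)
        (fun k => huX k p.1) (fun k => hyX k p.1) (tendsto_block hu p.1) (tendsto_block hy p.1)
      simp only [(hS.G_surrogate p.1).eq_self _ (hzX p.1)] at h1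
      exact h1
  · intro k
    obtain ⟨ν, κ, h⟩ := hkkt k
    exact ⟨ν, κ, h.2.2.1, h.2.1, h.1⟩

/-- Every limit point of a sequence of iterates is stationary. -/
theorem isStationary_of_mapClusterPt (hreg : ∀ z ∈ P.problem.feasible, P.problem.IsRegular z)
    (hP : P.Assumptions) (hS : P.SurrogateAssumptions S) {γ : ℕ → ℝ} {x xs : ℕ → BlockSpace I n}
    {μ : ℕ → Fin rt → ℝ} {lam : ℕ → Fin m → ℝ} (hrun : P.IsSDDM S γ x xs μ lam)
    {z : BlockSpace I n} (hz : MapClusterPt z Filter.atTop x) : P.problem.IsStationary z := by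
  have hγ : ∀ k, 0 ≤ γ k := fun k => (hrun.step_mem k).1.le
  have hopt : ∀ k, x k ∈ P.problem.feasible → (P.approx S (x k)).problem.IsOptimal (xs k) ∧
      ∃ ν κ, (P.approx S (x k)).problem.IsKKT (xs k) ν κ := fun k hk =>
    isOptimal_and_isKKT_of_isMasterOptimal hP hS (hreg _ hk) (hrun.master k) (hrun.sub k)
  -- Since `γ k ≤ 1`, the new iterate lies on the segment from `x k` to `xs k`, inside the convex
  -- feasible set of the approximate problem.
  have hfeas : ∀ k, x k ∈ P.problem.feasible := fun k => by
    induction k with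
    | zero => exact hrun.init
    | succ k ih =>
      rw [hrun.update]
      exact feasible_approx_subset hS ih.1 ((convex_feasible_approx hP hS ih.1).add_smul_sub_mem
        (mem_feasible_approx_self hS ih) (hopt k ih).1.1 ⟨hγ k, (hrun.step_mem k).2⟩)
  obtain ⟨c, hc, hquad⟩ := exists_quadratic_lower_bound hP hS
  obtain ⟨L, hL⟩ := exists_quadratic_upper_bound hP
  obtain ⟨B, hB⟩ := hP.f_bddBelow
  have hsum : Summable fun k => γ k * ‖xs k - x k‖ ^ 2 := by
    refine summable_mul_sq_of_descent (v := fun k => P.problem.f (x k)) (L := L) hc hγ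
      hrun.step_tendsto (fun k => hB ⟨x k, hfeas k, rfl⟩) fun k => ?_
    have h1 := hL _ (hfeas k).1 _ (hfeas (k + 1)).1
    have h2 := mul_le_mul_of_nonneg_left
      (fderiv_le_of_isOptimal_approx hP hS hquad (hfeas k) (hopt k (hfeas k)).1) (hγ k)
    have h3 : x (k + 1) - x k = γ k • (xs k - x k) := by rw [hrun.update, add_sub_cancel_left]
    rw [h3, map_smul, smul_eq_mul, norm_smul, Real.norm_of_nonneg (hγ k), mul_pow] at h1
    linarith
  have hzf : z ∈ P.problem.feasible := (isClosed_feasible hP).mem_of_mapClusterPt hz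
    (Filter.Eventually.of_forall hfeas)
  by_contra hns
  -- One `ε` serves as radius and as lower bound. In the negation the chosen indices need not
  -- increase: only `x (k N) → z` and `xs (k N) → z` matter.
  have hex : ∃ ε > 0, ∀ k, ‖x k - z‖ < ε → ε ≤ ‖xs k - x k‖ := by
    by_contra! hcon
    have hpos : ∀ N : ℕ, (0 : ℝ) < 1 / ((N : ℝ) + 1) := fun N => Nat.one_div_pos_of_nat
    choose k hk1 hk2 using fun N : ℕ => hcon (1 / ((N : ℝ) + 1)) (hpos N)
    have hy : Filter.Tendsto (fun N => x (k N)) Filter.atTop (nhds z) :=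
      tendsto_iff_norm_sub_tendsto_zero.2 (squeeze_zero (fun _ => norm_nonneg _)
        (fun N => (hk1 N).le) tendsto_one_div_add_atTop_nhds_zero_nat)
    have hd : Filter.Tendsto (fun N => xs (k N) - x (k N)) Filter.atTop (nhds 0) :=
      squeeze_zero_norm (fun N => (hk2 N).le) tendsto_one_div_add_atTop_nhds_zero_nat
    have hu : Filter.Tendsto (fun N => xs (k N)) Filter.atTop (nhds z) := by
      simpa using hd.add hy
    exact hns (isStationary_of_tendsto hP hS (hreg z hzf) (fun N => (hfeas (k N)).1)
      (fun N => (hopt _ (hfeas (k N))).2) hy hu)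
  obtain ⟨ε, hε, hle⟩ := hex
  exact not_mapClusterPt_of_summable_of_le_norm hγ hrun.step_sum hrun.update hsum hε hε hle hz

end SDDProblem

theorem mainTheorem8 {I : ℕ} {n r : Fin I → ℕ} {rt m : ℕ}
    (P : SDDProblem I n r rt m) (S : SDDSurrogate I n r rt)
    (γ : ℕ → ℝ) (x xs : ℕ → BlockSpace I n)
    (μ : ℕ → Fin rt → ℝ) (lam : ℕ → Fin m → ℝ)
    (hreg : ∀ z ∈ P.problem.feasible, P.problem.IsRegular z)
    (hP : P.Assumptions)
    (hS : P.SurrogateAssumptions S)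
    (hrun : P.IsSDDM S γ x xs μ lam)
    (hlim : ∃ z, MapClusterPt z Filter.atTop x) :
    ∃ z, MapClusterPt z Filter.atTop x ∧ P.problem.IsStationary z := by
  obtain ⟨z, hz⟩ := hlim
  exact ⟨z, hz, SDDProblem.isStationary_of_mapClusterPt hreg hP hS hrun hz⟩
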